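/- Let $d\in\mathbb N$ and let $\Gamma(t,x)=(4\pi t)^{-d/2}e^{-|x|^2/(4t)}$ be the heat kernel on $\mathbb R^d$. Let $E=(E_{ij})=\mathcal P\,\Gamma$ be the Stokes–Oseen kernel, where $\mathcal P$ is the Helmholtz (Leray–Hopf) projection, i.e. the Fourier multiplier with symbol $\delta_{ij}-\xi_i\xi_j/|\xi|^2$. A bounded mild solution of the incompressible Navier–Stokes equations $$u_t-\Delta u+u\cdot\nabla u+\nabla p=0,\qquad \operatorname{div}u=0\qquad\text{on }[0,1]\times\mathbb R^d$$ with bound $C$ is a (Lebesgue) measurable $u:[0,1]\times\mathbb R^d\to\mathbb R^d$, with $u(0,\cdot)$ measurable, such that $|u|\le C$ on $[0,1]\times\mathbb R^d$, $\operatorname{div}u(t,\cdot)=0$ in the sense of distributions for every $t\in[0,1]$, and for all $t\in(0,1]$, $x\in\mathbb R^d$ and $1\le i\le d$, $$u_i(t,x)=\int_{\mathbb R^d}\Gamma(t,x-y)\,u_i(0,y)\,dy-\int_0^t\sum_{j,k=1}^d\int_{\mathbb R^d}\partial_kE_{ij}(t-s,x-y)\,u_j(s,y)\,u_k(s,y)\,dy\,ds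 .$$ **Theorem.** For every $d$ and $C$ there is a constant $N\ge1$, depending only on $d$ and $C$, such that every bounded mild solution $u$ with bound $C$ has the following properties. For every $x\in\mathbb R^d$, the function $t\mapsto u(t,x)$ is $C^\infty$ on $(0,1]$ (with one-sided derivatives at $t=1$). For every $n\ge1$ and $t\in(0,1]$, $\partial_t^nu(t,\cdot)\in L_\infty(\mathbb R^d)$ and $t^n|\partial_t^nu(t,x)|\le N^{n+1}n^n$ for all $x\in\mathbb R^d$; in particular $$\sup_{t\in(0,1]}t^n\|\partial_t^nu(t,\cdot)\|_{L_\infty(\mathbb R^d)}\le N^{n+1}n^n .$$ Consequently, for every $x\in\mathbb R^d$, $t\mapsto u(t,x)$ is real analytic at every point of $(0,1]$ (at $t=1$, from the left: it equals a convergent power series in $t-1$ on some interval $(1-r,1]$). -/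

import Mathlib

open MeasureTheory Set
open scoped ContDiff FourierTransform

noncomputable section

/-- The Gauss-Weierstrass (heat) kernel `Γ(t,x) = (4πt)^{-d/2} exp (-|x|²/(4t))` on `ℝ^d`
(used for `t > 0`). -/
def heatKernel {d : ℕ} (t : ℝ) (x : EuclideanSpace ℝ (Fin d)) : ℝ :=
  (4 * Real.pi * t) ^ (-(d : ℝ) / 2) * Real.exp (-‖x‖ ^ 2 / (4 * t))

/-- The Fourier symbol `δ_{ij} - ξ_i ξ_j / |ξ|²` of the Helmholtz (Leray-Hopf) projection `𝒫`
onto divergence-free vector fields on `ℝ^d`. The symbol is homogeneous of degree zero, so it does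
not depend on the normalisation of the Fourier transform; its value at `ξ = 0` is immaterial. -/
def helmholtzSymbol {d : ℕ} (i j : Fin d) (ξ : EuclideanSpace ℝ (Fin d)) : ℝ :=
  (if i = j then 1 else 0) - ξ i * ξ j / ‖ξ‖ ^ 2

/-- The `(i,j)` entry of the Stokes-Oseen kernel `E(t,·) = 𝒫 Γ(t,·)`, that is, the Fourier
multiplier `𝒫` applied to the heat kernel. The inverse Fourier transform is real valued (the
function being transformed is real and even); `.re` only changes the codomain. -/
def stokesKernel {d : ℕ} (i j : Fin d) (t : ℝ) (x : EuclideanSpace ℝ (Fin d)) : ℝ :=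
  (𝓕⁻ (fun ξ : EuclideanSpace ℝ (Fin d) =>
    (helmholtzSymbol i j ξ : ℂ) *
      𝓕 (fun y : EuclideanSpace ℝ (Fin d) => (heatKernel t y : ℂ)) ξ) x).re

/-- The spatial derivative `∂_k E_{ij}(t,x)` of the Stokes-Oseen kernel. -/
def stokesKernelDeriv {d : ℕ} (i j k : Fin d) (t : ℝ) (x : EuclideanSpace ℝ (Fin d)) : ℝ :=
  fderiv ℝ (stokesKernel i j t) x (EuclideanSpace.single k 1)

/-- A vector field on `ℝ^d` is divergence free in the sense of distributions:
`∫ v · ∇φ = 0` for every test function `φ`. -/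
def WeaklyDivFree {d : ℕ} (v : EuclideanSpace ℝ (Fin d) → EuclideanSpace ℝ (Fin d)) : Prop :=
  ∀ φ : EuclideanSpace ℝ (Fin d) → ℝ, ContDiff ℝ ∞ φ → HasCompactSupport φ →
    ∫ x, fderiv ℝ φ x (v x) = 0

/-- `u` is a mild solution on `[0,1] × ℝ^d` of the incompressible Navier-Stokes equations
`u_t - Δu + u·∇u + ∇p = 0`, `div u = 0`, with `|u| ≤ C`. Only the values `u t x` with
`t ∈ [0,1]` matter.

The integral equation is
`u(t) = E(t) * u(0) - ∫₀ᵗ E(t-s) * ∇·(u ⊗ u)(s) ds`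
in its standard form for bounded fields: as `u(0)` is divergence free, `𝒫 u(0) = u(0)`, so
`E(t) * u(0)` is the absolutely convergent `Γ(t) * u(0)`, and the derivative falling on `u ⊗ u` is
moved to the kernel, `∇E(t-s)` being integrable on `ℝ^d` with norm `O((t-s)^{-1/2})`. -/
structure IsBoundedMildSolution {d : ℕ} (C : ℝ)
    (u : ℝ → EuclideanSpace ℝ (Fin d) → EuclideanSpace ℝ (Fin d)) : Prop where
  aestronglyMeasurable : AEStronglyMeasurable (Function.uncurry u)
    (volume.restrict (Icc (0 : ℝ) 1 ×ˢ (univ : Set (EuclideanSpace ℝ (Fin d)))))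
  aestronglyMeasurable_zero : AEStronglyMeasurable (u 0) volume
  bound : ∀ t ∈ Icc (0 : ℝ) 1, ∀ x, ‖u t x‖ ≤ C
  divFree : ∀ t ∈ Icc (0 : ℝ) 1, WeaklyDivFree (u t)
  integral_eq : ∀ t ∈ Ioc (0 : ℝ) 1, ∀ x, ∀ i : Fin d,
    u t x i = (∫ y, heatKernel t (x - y) * u 0 y i) -
      ∫ s in (0 : ℝ)..t, ∑ j : Fin d, ∑ k : Fin d,
        ∫ y, stokesKernelDeriv i j k (t - s) (x - y) * (u s y j * u s y k)

end

/-! The proof replaces differentiation in `t` by holomorphy in a dilation of time. For real `l` near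
1 the field `v(t,x) = u(lt,x)` satisfies, after the substitution `s ↦ ls`, the Duhamel equation
`v(t) = Γ(lt) * u(0) - ∫₀ᵗ l ∇E(l(t-s)) * (v ⊗ v)(s) ds` as long as `lt ≤ 1`. Now `l` enters only
through the kernels, and these extend holomorphically to complex `z` in the disc of radius 1/2 about
1, with a majorant that is integrable over space-time and independent of `z`.

For complex `z` the equation is solved by Picard iteration started at `u` itself
(`exists_holomorphic_family`). The map is a contraction by 1/2 in the norm weighted by `exp (-κ t)`,
for `κ` large. By the Schwarz lemma the first step moves `u` by `O(|z - 1|)`, so for `|z - 1| < ε`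
the iterates stay below `C + 1`, with `ε` depending only on `d` and `C`. Iterates are holomorphic in
`z` and converge uniformly in `z` at each space-time point; the limit is holomorphic. At real `z =
l`, uniqueness of the fixed point identifies it with `u(lt,x)`; causality permits this comparison up
to the time where `lt = 1`.

Hence `z ↦ u(zt,x)` extends to a holomorphic function bounded by `C + 1` on a disc whose radius does
not depend on `t`, `x` or `u` (`exists_holomorphic_dilation`). Its `n`-th derivative at `z = 1` is
`tⁿ ∂ₜⁿ u(t,x)`; Cauchy's estimate and `n! ≤ nⁿ` finish the proof.

The complex kernel comes from `stokesKernelDeriv_eq`: since `|ξ|⁻² exp(-4π²t|ξ|²)` is, up to a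
constant, `∫_t^∞ exp(-4π²r|ξ|²) dr`, the nonlocal part of `∂_k E_ij(t)` is `∫_t^∞ ∂_i∂_j∂_k Γ(r)
dr`, which involves only Gaussians. Gaussian bounds give it an `L¹` norm in space of order
`t^(-1/2)`, integrable near `t = 0`. -/

/-! ### Holomorphy of parametric integrals. -/

open Filter Topology Metric in
/-- A parametric integral of functions that are holomorphic in the parameter and dominated by a
fixed integrable function is holomorphic. -/
theorem differentiableOn_integral_of_dominated {α : Type*} [MeasurableSpace α] {μ : Measure α}
    {U : Set ℂ} (hU : IsOpen U) {F : ℂ → α → ℂ} {g : α → ℝ}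
    (hm : ∀ z ∈ U, AEStronglyMeasurable (F z) μ) (hb : ∀ᵐ a ∂μ, ∀ z ∈ U, ‖F z a‖ ≤ g a)
    (hg : Integrable g μ) (hd : ∀ᵐ a ∂μ, DifferentiableOn ℂ (fun z => F z a) U) :
    DifferentiableOn ℂ (fun z => ∫ a, F z a ∂μ) U := by
  intro z₀ hz₀
  obtain ⟨r, hr, hrU⟩ := Metric.isOpen_iff.1 hU z₀ hz₀
  -- Since 1/2 + 1/3 < 1, every centre near `z₀` carries a disc of radius `r / 3` inside `U`.
  -- Cauchy's estimate there turns the bound `g` on the functions into a bound on their derivatives.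
  have hsub : ∀ z ∈ ball z₀ (r / 2), closedBall z (r / 3) ⊆ U := by
    intro z hz w hw
    apply hrU
    rw [mem_ball] at hz ⊢
    rw [mem_closedBall] at hw
    linarith [dist_triangle w z z₀]
  have hmU : ∀ z ∈ ball z₀ (r / 2), z ∈ U := fun z hz =>
    hsub z hz (mem_closedBall_self (by positivity))
  have hder : ∀ᵐ a ∂μ, ∀ z ∈ U, HasDerivAt (fun z => F z a) (deriv (fun z => F z a) z) z := by
    filter_upwards [hd] with a ha z hz using (ha.differentiableAt (hU.mem_nhds hz)).hasDerivAt
  have hbound : ∀ᵐ a ∂μ, ∀ z ∈ ball z₀ (r / 2),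
      ‖deriv (fun z => F z a) z‖ ≤ g a / (r / 3) := by
    filter_upwards [hb, hd] with a hba hda z hz
    refine Complex.norm_deriv_le_of_forall_mem_sphere_norm_le (by positivity) ?_ ?_
    · refine DifferentiableOn.diffContOnCl ?_
      refine hda.mono ?_
      rw [closure_ball _ (by positivity)]
      exact hsub z hz
    · exact fun w hw => hba w (hsub z hz (sphere_subset_closedBall hw))
  -- The derivative is an almost everywhere limit of difference quotients along a null sequence of
  -- steps smaller than `r / 2`.
  have hmeas : AEStronglyMeasurable (fun a => deriv (fun z => F z a) z₀) μ := by
    let h : ℕ → ℂ := fun n => ((r / 2 / (n + 2) : ℝ) : ℂ)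
    have hpos : ∀ n : ℕ, 0 < r / 2 / (n + 2 : ℝ) := fun n => by positivity
    have hlt : ∀ n : ℕ, r / 2 / (n + 2 : ℝ) < r / 2 := fun n =>
      div_lt_self (by positivity) (by linarith [(Nat.cast_nonneg n : (0 : ℝ) ≤ n)])
    have hlim : Tendsto h atTop (𝓝[≠] 0) := by
      refine tendsto_nhdsWithin_iff.2 ⟨?_, Eventually.of_forall fun n => ?_⟩
      · have : Tendsto (fun n : ℕ => (r / 2 / (n + 2 : ℝ))) atTop (𝓝 0) :=
          Tendsto.const_div_atTop
            (tendsto_atTop_add_const_right _ _ tendsto_natCast_atTop_atTop) _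
        exact (Complex.continuous_ofReal.tendsto 0).comp this
      · exact Complex.ofReal_ne_zero.2 (hpos n).ne'
    refine aestronglyMeasurable_of_tendsto_ae atTop
      (f := fun n a => (h n)⁻¹ • (F (z₀ + h n) a - F z₀ a)) (fun n => ?_) ?_
    · refine AEStronglyMeasurable.fun_const_smul ((hm _ ?_).sub (hm _ hz₀)) _
      refine hmU _ ?_
      rw [mem_ball, dist_eq_norm, add_sub_cancel_left, Complex.norm_real, Real.norm_eq_abs,
        abs_of_pos (hpos n)]
      exact hlt n
    · filter_upwards [hder] with a ha using ((ha z₀ hz₀).tendsto_slope_zero).comp hlim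
  have := hasDerivAt_integral_of_dominated_loc_of_deriv_le (μ := μ) (F := F)
    (F' := fun z a => deriv (fun z => F z a) z) (x₀ := z₀) (bound := fun a => g a / (r / 3))
    (ball_mem_nhds z₀ (by positivity : 0 < r / 2))
    (by filter_upwards [hU.mem_nhds hz₀] with z hz using hm z hz)
    (hg.mono' (hm _ hz₀) (hb.mono fun a ha => ha z₀ hz₀)) hmeas hbound (hg.div_const _)
    (hder.mono fun a ha z hz => ha z (hmU z hz))
  exact this.2.differentiableAt.differentiableWithinAt

/-! ### Quadratic Duhamel terms for causal integrable kernels. -/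

/-- Space-time `ℝ × ℝ^d`. -/
abbrev SpaceTime (d : ℕ) : Type := ℝ × EuclideanSpace ℝ (Fin d)

instance SpaceTime.isAddHaarMeasure {d : ℕ} :
    (volume : Measure (SpaceTime d)).IsAddHaarMeasure :=
  Measure.prod.instIsAddHaarMeasure (volume : Measure ℝ)
    (volume : Measure (EuclideanSpace ℝ (Fin d)))

instance SpaceTime.isNegInvariant {d : ℕ} : (volume : Measure (SpaceTime d)).IsNegInvariant :=
  Measure.IsAddHaarMeasure.isNegInvariant_of_regular _

/-- A family of space-time convolution kernels that depends holomorphically on a parameter in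
`ball 1 ρ` and is dominated by a causal integrable kernel `H`. -/
structure IsDominatedKernel {d : ℕ} (K : Fin d → Fin d → Fin d → ℂ → SpaceTime d → ℂ) (ρ : ℝ)
    (H : SpaceTime d → ℝ) : Prop where
  differentiableOn : ∀ i j k q, DifferentiableOn ℂ (fun z => K i j k z q) (Metric.ball 1 ρ)
  measurable : ∀ i j k, ∀ z ∈ Metric.ball (1 : ℂ) ρ, Measurable (K i j k z)
  norm_le : ∀ i j k, ∀ z ∈ Metric.ball (1 : ℂ) ρ, ∀ q, ‖K i j k z q‖ ≤ H q
  integrable : Integrable H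
  nonneg : ∀ q, 0 ≤ H q
  -- Vanishing at time lag 0 as well means that only strictly earlier times contribute.
  causal : ∀ q : SpaceTime d, q.1 ≤ 0 → H q = 0

/-- The quadratic term of the Duhamel formula. -/
noncomputable def duhamel {d : ℕ} (K : Fin d → Fin d → Fin d → ℂ → SpaceTime d → ℂ) (z : ℂ)
    (v : SpaceTime d → Fin d → ℂ) (i : Fin d) (p : SpaceTime d) : ℂ :=
  ∑ j, ∑ k, ∫ q, K i j k z (p - q) * (v q j * v q k)

open Classical in
/-- The right-hand side of the Duhamel formula on the time interval `(0,1]`, extended by zero. -/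
noncomputable def picardStep {d : ℕ} (a : ℂ → Fin d → SpaceTime d → ℂ)
    (K : Fin d → Fin d → Fin d → ℂ → SpaceTime d → ℂ) (z : ℂ)
    (v : SpaceTime d → Fin d → ℂ) (p : SpaceTime d) (i : Fin d) : ℂ :=
  if p.1 ∈ Ioc (0 : ℝ) 1 then a z i p - duhamel K z v i p else 0

section Duhamel

variable {d : ℕ} {K : Fin d → Fin d → Fin d → ℂ → SpaceTime d → ℂ} {ρ : ℝ}
  {H : SpaceTime d → ℝ} {v w : SpaceTime d → Fin d → ℂ} {R : ℝ} {z : ℂ}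

theorem aestronglyMeasurable_component (hv : AEStronglyMeasurable v) (j : Fin d) :
    AEStronglyMeasurable (fun q => v q j) :=
  (continuous_apply j).comp_aestronglyMeasurable hv

theorem norm_mul_component_le (hR : ∀ q, ‖v q‖ ≤ R) (q : SpaceTime d) (j k : Fin d) :
    ‖v q j * v q k‖ ≤ R ^ 2 := by
  rw [norm_mul, sq]
  have h0 : 0 ≤ R := (norm_nonneg _).trans (hR q)
  exact mul_le_mul ((norm_le_pi_norm _ _).trans (hR q)) ((norm_le_pi_norm _ _).trans (hR q))
    (norm_nonneg _) h0

theorem integrable_kernel_sub (hH : Integrable H) (p : SpaceTime d) :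
    Integrable (fun q => H (p - q)) := hH.comp_sub_left p

theorem aestronglyMeasurable_duhamel_integrand (hK : IsDominatedKernel K ρ H)
    (hz : z ∈ Metric.ball (1 : ℂ) ρ) (hv : AEStronglyMeasurable v) (i j k : Fin d)
    (p : SpaceTime d) :
    AEStronglyMeasurable (fun q => K i j k z (p - q) * (v q j * v q k)) :=
  AEStronglyMeasurable.mul
    (((hK.measurable i j k z hz).comp (measurable_const.sub measurable_id)).aestronglyMeasurable)
    ((aestronglyMeasurable_component hv j).mul (aestronglyMeasurable_component hv k))

theorem norm_duhamel_integrand_le (hK : IsDominatedKernel K ρ H)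
    (hz : z ∈ Metric.ball (1 : ℂ) ρ) (hR : ∀ q, ‖v q‖ ≤ R) (i j k : Fin d) (p q : SpaceTime d) :
    ‖K i j k z (p - q) * (v q j * v q k)‖ ≤ H (p - q) * R ^ 2 := by
  rw [norm_mul]
  exact mul_le_mul (hK.norm_le i j k z hz _) (norm_mul_component_le hR q j k) (norm_nonneg _)
    (hK.nonneg _)

theorem integrable_duhamel_integrand (hK : IsDominatedKernel K ρ H)
    (hz : z ∈ Metric.ball (1 : ℂ) ρ) (hv : AEStronglyMeasurable v) (hR : ∀ q, ‖v q‖ ≤ R)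
    (i j k : Fin d) (p : SpaceTime d) :
    Integrable (fun q => K i j k z (p - q) * (v q j * v q k)) :=
  ((integrable_kernel_sub hK.integrable p).mul_const (R ^ 2)).mono'
    (aestronglyMeasurable_duhamel_integrand hK hz hv i j k p)
    (Filter.Eventually.of_forall (norm_duhamel_integrand_le hK hz hR i j k p))

theorem norm_sum_sum_le {f : Fin d → Fin d → ℂ} {c : ℝ} (h : ∀ j k, ‖f j k‖ ≤ c) :
    ‖∑ j, ∑ k, f j k‖ ≤ (d : ℝ) ^ 2 * c := by
  calc ‖∑ j, ∑ k, f j k‖ ≤ ∑ _j : Fin d, ∑ _k : Fin d, c :=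
        (norm_sum_le _ _).trans (Finset.sum_le_sum fun j _ => (norm_sum_le _ _).trans
          (Finset.sum_le_sum fun k _ => h j k))
    _ = (d : ℝ) ^ 2 * c := by simp; ring

theorem norm_duhamel_le (hK : IsDominatedKernel K ρ H) (hz : z ∈ Metric.ball (1 : ℂ) ρ)
    (hR : ∀ q, ‖v q‖ ≤ R) (i : Fin d) (p : SpaceTime d) :
    ‖duhamel K z v i p‖ ≤ (d : ℝ) ^ 2 * (R ^ 2 * ∫ q, H q) := by
  refine norm_sum_sum_le fun j k => ?_
  refine (norm_integral_le_of_norm_le ((integrable_kernel_sub hK.integrable p).mul_const (R ^ 2))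
    (Filter.Eventually.of_forall (norm_duhamel_integrand_le hK hz hR i j k p))).trans_eq ?_
  rw [integral_mul_const, integral_sub_left_eq_self H volume p, mul_comm]

theorem measurable_duhamel (hK : IsDominatedKernel K ρ H) (hz : z ∈ Metric.ball (1 : ℂ) ρ)
    (hv : Measurable v) (i : Fin d) : Measurable (duhamel K z v i) := by
  refine Finset.measurable_fun_sum _ fun j _ => Finset.measurable_fun_sum _ fun k _ => ?_
  refine StronglyMeasurable.measurable (StronglyMeasurable.integral_prod_right
    (f := fun p q => K i j k z (p - q) * (v q j * v q k)) ?_)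
  refine Measurable.stronglyMeasurable ?_
  refine ((hK.measurable i j k z hz).comp (measurable_fst.sub measurable_snd)).mul ?_
  exact ((measurable_pi_apply j).comp (hv.comp measurable_snd)).mul
    ((measurable_pi_apply k).comp (hv.comp measurable_snd))

theorem differentiableOn_duhamel (hK : IsDominatedKernel K ρ H) {ε : ℝ} (hε : ε ≤ ρ)
    {V : ℂ → SpaceTime d → Fin d → ℂ}
    (hV : ∀ z ∈ Metric.ball (1 : ℂ) ε, Measurable (V z))
    (hR : ∀ z ∈ Metric.ball (1 : ℂ) ε, ∀ q, ‖V z q‖ ≤ R)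
    (hd : ∀ q i, DifferentiableOn ℂ (fun z => V z q i) (Metric.ball 1 ε))
    (i : Fin d) (p : SpaceTime d) :
    DifferentiableOn ℂ (fun z => duhamel K z (V z) i p) (Metric.ball 1 ε) := by
  have hsub := Metric.ball_subset_ball (x := (1 : ℂ)) hε
  refine DifferentiableOn.fun_sum fun j _ => DifferentiableOn.fun_sum fun k _ => ?_
  refine differentiableOn_integral_of_dominated Metric.isOpen_ball
    (F := fun z q => K i j k z (p - q) * (V z q j * V z q k)) (g := fun q => H (p - q) * R ^ 2)
    (fun z hz => ?_) (Filter.Eventually.of_forall fun q z hz => ?_) ?_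
    (Filter.Eventually.of_forall fun q => ?_)
  · exact aestronglyMeasurable_duhamel_integrand hK (hsub hz)
      (hV z hz).aestronglyMeasurable i j k p
  · exact norm_duhamel_integrand_le hK (hsub hz) (hR z hz) i j k p q
  · exact (integrable_kernel_sub hK.integrable p).mul_const (R ^ 2)
  · exact ((hK.differentiableOn i j k (p - q)).mono hsub).mul ((hd q j).mul (hd q k))

theorem integrable_exp_mul_kernel (hK : IsDominatedKernel K ρ H) {κ : ℝ} (hκ : 0 ≤ κ) :
    Integrable (fun q : SpaceTime d => Real.exp (-(κ * q.1)) * H q) := by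
  refine hK.integrable.mono' ?_ (Filter.Eventually.of_forall fun q => ?_)
  · exact (by fun_prop : Measurable fun q : SpaceTime d =>
      Real.exp (-(κ * q.1))).aestronglyMeasurable.mul hK.integrable.1
  · rcases le_or_gt q.1 0 with h | h
    · simp [hK.causal q h]
    · rw [Real.norm_eq_abs, abs_of_nonneg (mul_nonneg (Real.exp_nonneg _) (hK.nonneg q))]
      refine mul_le_of_le_one_left (hK.nonneg q) (Real.exp_le_one_iff.2 ?_)
      have := mul_nonneg hκ h.le
      linarith

-- Dominated convergence as `κ → ∞`, the mass of `H` lying in positive times. This is what makes the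
-- Picard map contract on the whole time interval, whatever the size of the data.
open Filter Topology in
theorem exists_integral_exp_mul_kernel_le (hK : IsDominatedKernel K ρ H) {δ : ℝ} (hδ : 0 < δ) :
    ∃ κ : ℝ, 0 ≤ κ ∧ ∫ q : SpaceTime d, Real.exp (-(κ * q.1)) * H q ≤ δ := by
  have : Tendsto (fun n : ℕ => ∫ q : SpaceTime d, Real.exp (-((n : ℝ) * q.1)) * H q) atTop
      (𝓝 (∫ _q : SpaceTime d, (0 : ℝ))) := by
    refine tendsto_integral_of_dominated_convergence H (fun n => ?_) hK.integrable
      (fun n => Eventually.of_forall fun q => ?_) (Eventually.of_forall fun q => ?_)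
    · exact (integrable_exp_mul_kernel hK (Nat.cast_nonneg n)).1
    · rcases le_or_gt q.1 0 with h | h
      · simp [hK.causal q h]
      · rw [Real.norm_eq_abs, abs_of_nonneg (mul_nonneg (Real.exp_nonneg _) (hK.nonneg q))]
        refine mul_le_of_le_one_left (hK.nonneg q) (Real.exp_le_one_iff.2 ?_)
        have := mul_nonneg (Nat.cast_nonneg (α := ℝ) n) h.le
        linarith
    · rcases le_or_gt q.1 0 with h | h
      · simp [hK.causal q h]
      · have h1 : Tendsto (fun n : ℕ => (n : ℝ) * q.1) atTop atTop :=
          tendsto_natCast_atTop_atTop.atTop_mul_const h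
        simpa using (Real.tendsto_exp_neg_atTop_nhds_zero.comp h1).mul_const (H q)
  rw [integral_zero] at this
  obtain ⟨n, hn⟩ := (this.eventually (gt_mem_nhds hδ)).exists
  exact ⟨n, Nat.cast_nonneg n, hn.le⟩

/-- The weight is multiplicative, `exp (κ s) = exp (κ t) exp (-κ (t - s))`, so it passes onto the
kernel; the factor `2 * R` comes from polarising the quadratic term. By causality the hypothesis is
needed only at times before `p.1`, which later allows comparison with a field that solves the
equation on a shorter interval. -/
theorem norm_duhamel_sub_le (hK : IsDominatedKernel K ρ H) (hz : z ∈ Metric.ball (1 : ℂ) ρ)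
    (hv : AEStronglyMeasurable v) (hw : AEStronglyMeasurable w)
    (hvR : ∀ q, ‖v q‖ ≤ R) (hwR : ∀ q, ‖w q‖ ≤ R) {κ A : ℝ} (hκ : 0 ≤ κ) (p : SpaceTime d)
    (hA : ∀ q : SpaceTime d, q.1 < p.1 → ‖v q - w q‖ ≤ A * Real.exp (κ * q.1)) (i : Fin d) :
    ‖duhamel K z v i p - duhamel K z w i p‖ ≤
      (d : ℝ) ^ 2 * ((2 * R * A * Real.exp (κ * p.1)) *
        ∫ q : SpaceTime d, Real.exp (-(κ * q.1)) * H q) := by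
  have hR0 : 0 ≤ R := (norm_nonneg _).trans (hvR p)
  unfold duhamel
  rw [← Finset.sum_sub_distrib]
  simp_rw [← Finset.sum_sub_distrib]
  refine norm_sum_sum_le fun j k => ?_
  rw [← integral_sub (integrable_duhamel_integrand hK hz hv hvR i j k p)
    (integrable_duhamel_integrand hK hz hw hwR i j k p), ← integral_const_mul,
    ← integral_sub_left_eq_self (fun q : SpaceTime d => 2 * R * A * Real.exp (κ * p.1) *
      (Real.exp (-(κ * q.1)) * H q)) volume p]
  have hint := ((integrable_exp_mul_kernel hK hκ).const_mul
    (2 * R * A * Real.exp (κ * p.1))).comp_sub_left p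
  refine norm_integral_le_of_norm_le hint (Filter.Eventually.of_forall fun q => ?_)
  simp only [Prod.fst_sub]
  rcases le_or_gt p.1 q.1 with h | h
  · have hH : H (p - q) = 0 := hK.causal _ (by simpa using h)
    have hK0 : K i j k z (p - q) = 0 := by
      have := hK.norm_le i j k z hz (p - q)
      rw [hH] at this
      exact norm_le_zero_iff.1 this
    simp [hH, hK0]
  · have e1 : Real.exp (κ * p.1) * Real.exp (-(κ * (p.1 - q.1))) = Real.exp (κ * q.1) := by
      rw [← Real.exp_add]; ring_nf
    have hdiff : ‖v q j * v q k - w q j * w q k‖ ≤ 2 * R * (A * Real.exp (κ * q.1)) := by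
      have e2 : v q j * v q k - w q j * w q k
          = v q j * (v q k - w q k) + (v q j - w q j) * w q k := by ring
      have h1 : ∀ l, ‖v q l - w q l‖ ≤ A * Real.exp (κ * q.1) := fun l =>
        (norm_le_pi_norm (v q - w q) l).trans (hA q h)
      have h2 : ‖v q j‖ ≤ R := (norm_le_pi_norm _ _).trans (hvR q)
      have h3 : ‖w q k‖ ≤ R := (norm_le_pi_norm _ _).trans (hwR q)
      rw [e2]
      refine (norm_add_le _ _).trans ?_
      rw [norm_mul, norm_mul]
      have h4 := mul_le_mul h2 (h1 k) (norm_nonneg _) hR0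
      have h5 := mul_le_mul (h1 j) h3 (norm_nonneg _) ((norm_nonneg _).trans (h1 j))
      linarith
    rw [← mul_sub, norm_mul]
    calc ‖K i j k z (p - q)‖ * ‖v q j * v q k - w q j * w q k‖
        ≤ H (p - q) * (2 * R * (A * Real.exp (κ * q.1))) :=
          mul_le_mul (hK.norm_le i j k z hz _) hdiff (norm_nonneg _) (hK.nonneg _)
      _ = 2 * R * A * Real.exp (κ * p.1) * (Real.exp (-(κ * (p.1 - q.1))) * H (p - q)) := by
          rw [← e1]; ring

end Duhamel

/-! ### Picard iteration with a holomorphic parameter. -/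

section Picard

variable {d : ℕ} {K : Fin d → Fin d → Fin d → ℂ → SpaceTime d → ℂ} {ρ : ℝ}
  {H : SpaceTime d → ℝ} {a : ℂ → Fin d → SpaceTime d → ℂ} {v w : SpaceTime d → Fin d → ℂ}
  {R : ℝ} {z : ℂ}

theorem picardStep_of_mem {p : SpaceTime d} (hp : p.1 ∈ Ioc (0 : ℝ) 1) (i : Fin d) :
    picardStep a K z v p i = a z i p - duhamel K z v i p := if_pos hp

theorem picardStep_of_notMem {p : SpaceTime d} (hp : p.1 ∉ Ioc (0 : ℝ) 1) :
    picardStep a K z v p = 0 := funext fun _ => if_neg hp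

theorem measurable_picardStep (hK : IsDominatedKernel K ρ H) (hz : z ∈ Metric.ball (1 : ℂ) ρ)
    (ha : ∀ i, Measurable (a z i)) (hv : Measurable v) : Measurable (picardStep a K z v) :=
  measurable_pi_lambda _ fun i => Measurable.ite (measurableSet_Ioc.preimage measurable_fst)
    ((ha i).sub (measurable_duhamel hK hz hv i)) measurable_const

theorem norm_picardStep_sub_le (hK : IsDominatedKernel K ρ H) (hz : z ∈ Metric.ball (1 : ℂ) ρ)
    (hv : AEStronglyMeasurable v) (hw : AEStronglyMeasurable w)
    (hvR : ∀ q, ‖v q‖ ≤ R) (hwR : ∀ q, ‖w q‖ ≤ R) {κ A : ℝ} (hκ : 0 ≤ κ) (hA0 : 0 ≤ A)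
    (hsmall : (d : ℝ) ^ 2 * (2 * R * ∫ q : SpaceTime d, Real.exp (-(κ * q.1)) * H q) ≤ 1 / 2)
    (p : SpaceTime d)
    (hA : ∀ q : SpaceTime d, q.1 < p.1 → ‖v q - w q‖ ≤ A * Real.exp (κ * q.1)) :
    ‖picardStep a K z v p - picardStep a K z w p‖ ≤ A / 2 * Real.exp (κ * p.1) := by
  have h0 : 0 ≤ A / 2 * Real.exp (κ * p.1) := by positivity
  by_cases hp : p.1 ∈ Ioc (0 : ℝ) 1
  · refine (pi_norm_le_iff_of_nonneg h0).2 fun i => ?_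
    rw [Pi.sub_apply, picardStep_of_mem hp, picardStep_of_mem hp, sub_sub_sub_cancel_left,
      norm_sub_rev]
    refine (norm_duhamel_sub_le hK hz hv hw hvR hwR hκ p hA i).trans ?_
    calc _ = ((d : ℝ) ^ 2 * (2 * R * ∫ q : SpaceTime d, Real.exp (-(κ * q.1)) * H q)) *
          (A * Real.exp (κ * p.1)) := by ring
      _ ≤ 1 / 2 * (A * Real.exp (κ * p.1)) := by gcongr
      _ = _ := by ring
  · rw [picardStep_of_notMem hp, picardStep_of_notMem hp]
    simpa using h0

theorem norm_picardStep_le (hK : IsDominatedKernel K ρ H) (hz : z ∈ Metric.ball (1 : ℂ) ρ)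
    {M : ℝ} (hM : 0 ≤ M) (haM : ∀ i p, p.1 ∈ Ioc (0 : ℝ) 1 → ‖a z i p‖ ≤ M)
    (hvR : ∀ q, ‖v q‖ ≤ R) (p : SpaceTime d) :
    ‖picardStep a K z v p‖ ≤ M + (d : ℝ) ^ 2 * (R ^ 2 * ∫ q, H q) := by
  have hI : 0 ≤ ∫ q, H q := integral_nonneg hK.nonneg
  have h0 : 0 ≤ M + (d : ℝ) ^ 2 * (R ^ 2 * ∫ q, H q) := by positivity
  by_cases hp : p.1 ∈ Ioc (0 : ℝ) 1
  · refine (pi_norm_le_iff_of_nonneg h0).2 fun i => ?_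
    rw [picardStep_of_mem hp]
    exact (norm_sub_le _ _).trans (add_le_add (haM i p hp) (norm_duhamel_le hK hz hvR i p))
  · rw [picardStep_of_notMem hp]
    simpa using h0

theorem differentiableOn_picardStep (hK : IsDominatedKernel K ρ H) {ε : ℝ} (hε : ε ≤ ρ)
    (ha : ∀ i p, p.1 ∈ Ioc (0 : ℝ) 1 → DifferentiableOn ℂ (fun z => a z i p) (Metric.ball 1 ρ))
    {V : ℂ → SpaceTime d → Fin d → ℂ}
    (hV : ∀ z ∈ Metric.ball (1 : ℂ) ε, Measurable (V z))
    (hR : ∀ z ∈ Metric.ball (1 : ℂ) ε, ∀ q, ‖V z q‖ ≤ R)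
    (hd : ∀ q i, DifferentiableOn ℂ (fun z => V z q i) (Metric.ball 1 ε))
    (p : SpaceTime d) (i : Fin d) :
    DifferentiableOn ℂ (fun z => picardStep a K z (V z) p i) (Metric.ball 1 ε) := by
  by_cases hp : p.1 ∈ Ioc (0 : ℝ) 1
  · simp only [picardStep_of_mem hp]
    exact ((ha i p hp).mono (Metric.ball_subset_ball hε)).sub
      (differentiableOn_duhamel hK hε hV hR hd i p)
  · simp only [picardStep_of_notMem hp, Pi.zero_apply]
    exact differentiableOn_const _

/-- Schwarz lemma for the Picard map at a fixed field. -/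
theorem norm_picardStep_sub_picardStep_one_le (hK : IsDominatedKernel K ρ H) (hρ : 0 < ρ)
    (hz : z ∈ Metric.ball (1 : ℂ) ρ) {M : ℝ} (hM : 0 ≤ M)
    (ha : ∀ i p, p.1 ∈ Ioc (0 : ℝ) 1 → DifferentiableOn ℂ (fun z => a z i p) (Metric.ball 1 ρ))
    (haM : ∀ z ∈ Metric.ball (1 : ℂ) ρ, ∀ i p, p.1 ∈ Ioc (0 : ℝ) 1 → ‖a z i p‖ ≤ M)
    (hv : Measurable v) (hvR : ∀ q, ‖v q‖ ≤ R) (p : SpaceTime d) :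
    ‖picardStep a K z v p - picardStep a K 1 v p‖ ≤
      2 * (M + (d : ℝ) ^ 2 * (R ^ 2 * ∫ q, H q)) / ρ * ‖z - 1‖ := by
  have hI : 0 ≤ ∫ q, H q := integral_nonneg hK.nonneg
  refine (pi_norm_le_iff_of_nonneg (by positivity)).2 fun i => ?_
  have h1 : (1 : ℂ) ∈ Metric.ball (1 : ℂ) ρ := Metric.mem_ball_self hρ
  have hbd : ∀ z ∈ Metric.ball (1 : ℂ) ρ, ‖picardStep a K z v p i‖ ≤
      M + (d : ℝ) ^ 2 * (R ^ 2 * ∫ q, H q) := fun z hz =>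
    (norm_le_pi_norm _ _).trans (norm_picardStep_le hK hz hM (haM z hz) hvR p)
  -- Two values of a function bounded by `B` differ by at most `2 * B`, so the disc is mapped into
  -- the closed ball of radius `2 * B` about the value at 1.
  have := Complex.dist_le_div_mul_dist_of_mapsTo_ball (f := fun z => picardStep a K z v p i)
    (R₂ := 2 * (M + (d : ℝ) ^ 2 * (R ^ 2 * ∫ q, H q)))
    (differentiableOn_picardStep hK le_rfl ha (V := fun _ => v) (fun _ _ => hv)
      (fun _ _ => hvR) (fun _ _ => differentiableOn_const _) p i)
    (fun y hy => by
      rw [Metric.mem_closedBall, dist_eq_norm]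
      refine (norm_sub_le _ _).trans ?_
      linarith [hbd y hy, hbd 1 h1]) hz
  simpa [dist_eq_norm] using this

/-- The Picard iterates starting from `U`. -/
noncomputable def picardIterate (a : ℂ → Fin d → SpaceTime d → ℂ)
    (K : Fin d → Fin d → Fin d → ℂ → SpaceTime d → ℂ) (U : SpaceTime d → Fin d → ℂ) :
    ℕ → ℂ → SpaceTime d → Fin d → ℂ
  | 0, _ => U
  | n + 1, z => picardStep a K z (picardIterate a K U n z)

open Filter Topology in
/-- A bounded fixed point of the Picard map at parameter `1` extends to a family of bounded
fields depending holomorphically on the parameter, and this family agrees with every bounded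
causal fixed point, on the time interval where the latter is one. The radius depends only on the
bounds. -/
theorem exists_holomorphic_family (hK : IsDominatedKernel K ρ H) (hρ : 0 < ρ) {C M : ℝ}
    (hC : 0 ≤ C) (hM : 0 ≤ M) :
    ∃ ε : ℝ, 0 < ε ∧ ε ≤ ρ ∧ ∀ (a : ℂ → Fin d → SpaceTime d → ℂ)
      (U : SpaceTime d → Fin d → ℂ),
      (∀ i p, p.1 ∈ Ioc (0 : ℝ) 1 → DifferentiableOn ℂ (fun z => a z i p) (Metric.ball 1 ρ)) →
      (∀ z ∈ Metric.ball (1 : ℂ) ρ, ∀ i, Measurable (a z i)) →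
      (∀ z ∈ Metric.ball (1 : ℂ) ρ, ∀ i p, p.1 ∈ Ioc (0 : ℝ) 1 → ‖a z i p‖ ≤ M) →
      Measurable U → (∀ p, ‖U p‖ ≤ C) → (∀ p, picardStep a K 1 U p = U p) →
      ∃ f : SpaceTime d → Fin d → ℂ → ℂ,
        (∀ p i, DifferentiableOn ℂ (f p i) (Metric.ball 1 ε)) ∧
        (∀ p i, ∀ z ∈ Metric.ball (1 : ℂ) ε, ‖f p i z‖ ≤ C + 1) ∧
        ∀ z ∈ Metric.ball (1 : ℂ) ε, ∀ (T : ℝ) (w : SpaceTime d → Fin d → ℂ),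
          AEStronglyMeasurable w → (∀ p, ‖w p‖ ≤ C + 1) →
          (∀ p : SpaceTime d, p.1 ≤ 1 → p.1 ≤ T → w p = picardStep a K z w p) →
          ∀ p : SpaceTime d, p.1 ≤ 1 → p.1 ≤ T → ∀ i, f p i z = w p i := by
  -- The iterates are allowed to drift by 1 from `U`.
  set R : ℝ := C + 1 with hR
  have hR0 : 0 ≤ R := by positivity
  have hI : 0 ≤ ∫ q, H q := integral_nonneg hK.nonneg
  -- The choice of `δ` gives `2 * d² * R * δ ≤ 1/2`, the contraction ratio; the `+ 1` keeps the
  -- denominator positive.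
  obtain ⟨κ, hκ, hκδ⟩ := exists_integral_exp_mul_kernel_le hK
    (δ := 1 / (4 * (d : ℝ) ^ 2 * R + 1)) (by positivity)
  have hsmall : (d : ℝ) ^ 2 * (2 * R * ∫ q : SpaceTime d, Real.exp (-(κ * q.1)) * H q)
      ≤ 1 / 2 := by
    calc _ ≤ (d : ℝ) ^ 2 * (2 * R * (1 / (4 * (d : ℝ) ^ 2 * R + 1))) := by gcongr
      _ ≤ 1 / 2 := by
        rw [← mul_assoc, mul_one_div, div_le_div_iff₀ (by positivity) (by positivity)]
        nlinarith
  set B : ℝ := M + (d : ℝ) ^ 2 * (C ^ 2 * ∫ q, H q) with hB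
  have hB0 : 0 ≤ B := by positivity
  -- A weighted distance of `η` means an actual distance of at most `η * exp κ = 1` up to time 1.
  set η : ℝ := Real.exp (-κ) with hη
  have hη0 : 0 < η := Real.exp_pos _
  -- Chosen so that the Schwarz bound `2 * B / ρ * ‖z - 1‖` on the first step is at most `η / 2`.
  -- All constants are fixed before `a` and `U` appear.
  set ε : ℝ := min ρ (η * ρ / (4 * (B + 1))) with hε
  have hεpos : 0 < ε := lt_min hρ (by positivity)
  have hερ : ε ≤ ρ := min_le_left _ _
  refine ⟨ε, hεpos, hερ, fun a U had ham haM hUm hUC hfix => ?_⟩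
  have hsub := Metric.ball_subset_ball (x := (1 : ℂ)) hερ
  have hUoff : ∀ p : SpaceTime d, p.1 ∉ Ioc (0 : ℝ) 1 → U p = 0 := fun p hp => by
    rw [← hfix p, picardStep_of_notMem hp]
  set V := picardIterate a K U with hV
  have hVsucc : ∀ n z, V (n + 1) z = picardStep a K z (V n z) := fun n z => rfl
  have hVoff : ∀ n z, ∀ p : SpaceTime d, p.1 ∉ Ioc (0 : ℝ) 1 → V n z p = 0 := by
    intro n z p hp
    cases n with
    | zero => exact hUoff p hp
    | succ n => rw [hVsucc, picardStep_of_notMem hp]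
  have hUR : ∀ p, ‖U p‖ ≤ R := fun p => (hUC p).trans (by linarith)
  have hstart : ∀ z ∈ Metric.ball (1 : ℂ) ε, ∀ p, ‖picardStep a K z U p - U p‖ ≤
      η / 2 * Real.exp (κ * p.1) := by
    intro z hz p
    by_cases hp : p.1 ∈ Ioc (0 : ℝ) 1
    · have h1 := norm_picardStep_sub_picardStep_one_le hK hρ (hsub hz) hM had haM hUm hUC p
      rw [hfix p] at h1
      have h2 : ‖z - 1‖ ≤ η * ρ / (4 * (B + 1)) := by
        have := hz.out.le.trans (min_le_right _ _)
        rwa [dist_eq_norm] at this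
      calc _ ≤ 2 * B / ρ * ‖z - 1‖ := h1
        _ ≤ 2 * B / ρ * (η * ρ / (4 * (B + 1))) := by gcongr
        _ = η / 2 * (B / (B + 1)) := by field_simp; ring
        _ ≤ η / 2 * 1 := by
          gcongr
          exact (div_le_one (by positivity)).2 (by linarith)
        _ ≤ η / 2 * Real.exp (κ * p.1) := by
          gcongr
          exact Real.one_le_exp (mul_nonneg hκ hp.1.le)
    · rw [picardStep_of_notMem hp, hUoff p hp, sub_zero, norm_zero]
      positivity
  -- The weighted ball of radius `η` about `U` is invariant: half of `η` comes from the contraction,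
  -- half from the displacement `hstart` of the centre.
  have hinv : ∀ n, ∀ z ∈ Metric.ball (1 : ℂ) ε, Measurable (V n z) ∧ (∀ p, ‖V n z p‖ ≤ R) ∧
      ∀ p, ‖V n z p - U p‖ ≤ η * Real.exp (κ * p.1) := by
    intro n
    induction n with
    | zero =>
      refine fun z hz => ⟨hUm, hUR, fun p => ?_⟩
      rw [show V 0 z p = U p from rfl, sub_self, norm_zero]
      positivity
    | succ n ih =>
      intro z hz
      obtain ⟨hm, hb, hdist⟩ := ih z hz
      have hdist' : ∀ p, ‖V (n + 1) z p - U p‖ ≤ η * Real.exp (κ * p.1) := by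
        intro p
        have h1 := norm_picardStep_sub_le (a := a) hK (hsub hz) hm.aestronglyMeasurable
          hUm.aestronglyMeasurable hb hUR hκ hη0.le hsmall p fun q _ => hdist q
        have h2 := norm_add_le (picardStep a K z (V n z) p - picardStep a K z U p)
          (picardStep a K z U p - U p)
        rw [sub_add_sub_cancel] at h2
        rw [hVsucc]
        linarith [hstart z hz p]
      refine ⟨measurable_picardStep hK (hsub hz) (ham z (hsub hz)) hm, fun p => ?_, hdist'⟩
      by_cases hp : p.1 ∈ Ioc (0 : ℝ) 1
      · have h1 : η * Real.exp (κ * p.1) ≤ 1 := by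
          rw [hη, ← Real.exp_add, Real.exp_le_one_iff]
          nlinarith [hp.2]
        have h2 := norm_add_le (V (n + 1) z p - U p) (U p)
        rw [sub_add_cancel] at h2
        linarith [hdist' p, hUC p]
      · rw [hVoff _ _ _ hp, norm_zero]
        exact hR0
  have hcontr : ∀ n, ∀ z ∈ Metric.ball (1 : ℂ) ε, ∀ p, ‖V n z p - V (n + 1) z p‖ ≤
      η * (1 / 2) ^ n * Real.exp (κ * p.1) := by
    intro n z hz
    induction n with
    | zero =>
      intro p
      rw [norm_sub_rev]
      rw [pow_zero, mul_one]
      exact (hinv 1 z hz).2.2 p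
    | succ n ih =>
      intro p
      have := norm_picardStep_sub_le (a := a) hK (hsub hz) (hinv n z hz).1.aestronglyMeasurable
        (hinv (n + 1) z hz).1.aestronglyMeasurable (hinv n z hz).2.1 (hinv (n + 1) z hz).2.1 hκ
        (by positivity) hsmall p fun q _ => ih q
      rw [hVsucc n, hVsucc (n + 1), pow_succ]
      refine this.trans_eq ?_
      ring
  have hdist : ∀ n, ∀ z ∈ Metric.ball (1 : ℂ) ε, ∀ p i,
      dist (V n z p i) (V (n + 1) z p i) ≤ η * Real.exp (κ * p.1) * (1 / 2) ^ n := by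
    intro n z hz p i
    rw [dist_eq_norm]
    refine (norm_le_pi_norm (V n z p - V (n + 1) z p) i).trans ((hcontr n z hz p).trans_eq ?_)
    ring
  have hconv : ∀ z ∈ Metric.ball (1 : ℂ) ε, ∀ p i, Tendsto (fun n => V n z p i) atTop
      (𝓝 (limUnder atTop fun n => V n z p i)) := fun z hz p i =>
    (cauchySeq_of_le_geometric (1 / 2) _ (by norm_num)
      (fun n => hdist n z hz p i)).tendsto_limUnder
  refine ⟨fun p i z => limUnder atTop fun n => V n z p i, fun p i => ?_, fun p i z hz => ?_,
    fun z hz T w hwm hwR hw p hp1 hpT i => ?_⟩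
  · have hunif : TendstoUniformlyOn (fun n z => V n z p i)
        (fun z => limUnder atTop fun n => V n z p i) atTop (Metric.ball 1 ε) := by
      rw [Metric.tendstoUniformlyOn_iff]
      intro e he
      have h0 : Tendsto (fun n : ℕ => η * Real.exp (κ * p.1) * (1 / 2) ^ n / (1 - 1 / 2)) atTop
          (𝓝 (η * Real.exp (κ * p.1) * 0 / (1 - 1 / 2))) :=
        ((tendsto_pow_atTop_nhds_zero_of_lt_one (by norm_num) (by norm_num)).const_mul
          _).div_const _
      rw [mul_zero, zero_div] at h0
      filter_upwards [h0.eventually (gt_mem_nhds he)] with n hn z hz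
      rw [dist_comm]
      exact (dist_le_of_le_geometric_of_tendsto (1 / 2) _ (by norm_num)
        (fun n => hdist n z hz p i) (hconv z hz p i) n).trans_lt hn
    refine hunif.tendstoLocallyUniformlyOn.differentiableOn (Eventually.of_forall fun n => ?_)
      Metric.isOpen_ball
    have hdiff : ∀ n q i, DifferentiableOn ℂ (fun z => V n z q i) (Metric.ball 1 ε) := by
      intro n
      induction n with
      | zero => exact fun q i => differentiableOn_const _
      | succ n ih =>
        exact fun q i => differentiableOn_picardStep hK hερ had (fun z hz => (hinv n z hz).1)
          (fun z hz => (hinv n z hz).2.1) ih q i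
    exact hdiff n p i
  · exact le_of_tendsto (hconv z hz p i).norm (Eventually.of_forall fun n =>
      (norm_le_pi_norm _ _).trans ((hinv n z hz).2.1 p))
  -- The iterates approach any bounded fixed point geometrically. Restricting to times up to `min 1
  -- T` is consistent because the contraction estimate looks only backwards in time.
  · have hle : ∀ n, ∀ p : SpaceTime d, p.1 ≤ 1 → p.1 ≤ T →
        ‖V n z p - w p‖ ≤ 2 * R * (1 / 2) ^ n * Real.exp (κ * p.1) := by
      intro n
      induction n with
      | zero =>
        intro p hp1 hpT
        by_cases hp : p.1 ∈ Ioc (0 : ℝ) 1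
        · calc _ ≤ 2 * R := (norm_sub_le _ _).trans (by linarith [(hinv 0 z hz).2.1 p, hwR p])
            _ ≤ 2 * R * (1 / 2) ^ 0 * Real.exp (κ * p.1) := by
              rw [pow_zero, mul_one]
              exact le_mul_of_one_le_right (by positivity)
                (Real.one_le_exp (mul_nonneg hκ hp.1.le))
        · rw [hVoff _ _ _ hp, hw p hp1 hpT, picardStep_of_notMem hp, sub_zero, norm_zero]
          positivity
      | succ n ih =>
        intro p hp1 hpT
        have := norm_picardStep_sub_le (a := a) hK (hsub hz)
          (hinv n z hz).1.aestronglyMeasurable hwm (hinv n z hz).2.1 hwR hκ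
          (by positivity) hsmall p fun q hq => ih q (hq.le.trans hp1) (hq.le.trans hpT)
        rw [hVsucc n, hw p hp1 hpT, pow_succ]
        refine this.trans_eq ?_
        ring
    refine tendsto_nhds_unique (hconv z hz p i) (tendsto_iff_norm_sub_tendsto_zero.2 ?_)
    have h0 : Tendsto (fun n : ℕ => 2 * R * (1 / 2) ^ n * Real.exp (κ * p.1)) atTop
        (𝓝 (2 * R * 0 * Real.exp (κ * p.1))) :=
      ((tendsto_pow_atTop_nhds_zero_of_lt_one (by norm_num) (by norm_num)).const_mul
        _).mul_const _
    rw [mul_zero, zero_mul] at h0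
    exact squeeze_zero (fun _ => norm_nonneg _) (fun n =>
      (norm_le_pi_norm (V n z p - w p) i).trans (hle n p hp1 hpT)) h0

end Picard

/-! ### Gaussian bounds and holomorphy for the heat kernel at complex time. -/

/-- The heat kernel at complex time. -/
noncomputable def complexHeatKernel {d : ℕ} (Z : ℂ) (y : EuclideanSpace ℝ (Fin d)) : ℂ :=
  (4 * Real.pi * Z) ^ (-(d : ℂ) / 2) * Complex.exp (-(‖y‖ : ℂ) ^ 2 / (4 * Z))

/-- The first spatial derivatives of the heat kernel at complex time. -/
noncomputable def heatGrad {d : ℕ} (k : Fin d) (Z : ℂ) (y : EuclideanSpace ℝ (Fin d)) : ℂ :=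
  -(y k : ℂ) / (2 * Z) * complexHeatKernel Z y

/-- The third spatial derivatives of the heat kernel at complex time. -/
noncomputable def heatThird {d : ℕ} (i j k : Fin d) (Z : ℂ) (y : EuclideanSpace ℝ (Fin d)) : ℂ :=
  (-((y i : ℂ) * y j * y k) / (8 * Z ^ 3) + ((if i = j then 1 else 0) * (y k : ℂ) +
    (if i = k then 1 else 0) * (y j : ℂ) + (if j = k then 1 else 0) * (y i : ℂ)) / (4 * Z ^ 2)) *
    complexHeatKernel Z y

section Bounds

variable {d : ℕ}

theorem complexHeatKernel_ofReal {t : ℝ} (ht : 0 < t) (y : EuclideanSpace ℝ (Fin d)) :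
    complexHeatKernel (t : ℂ) y = (heatKernel t y : ℂ) := by
  unfold complexHeatKernel heatKernel
  push_cast
  rw [Complex.ofReal_cpow (by positivity)]
  push_cast
  rfl

theorem heatKernel_nonneg {t : ℝ} (ht : 0 < t) (y : EuclideanSpace ℝ (Fin d)) :
    0 ≤ heatKernel t y := by
  unfold heatKernel
  positivity

theorem heatKernel_eq_const_mul {t : ℝ} (y : EuclideanSpace ℝ (Fin d)) :
    heatKernel t y = (4 * Real.pi * t) ^ (-(d : ℝ) / 2) *
      Real.exp (-(1 / (4 * t)) * ‖y‖ ^ 2) := by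
  unfold heatKernel
  congr 2
  ring

theorem integral_heatKernel {t : ℝ} (ht : 0 < t) :
    ∫ y : EuclideanSpace ℝ (Fin d), heatKernel t y = 1 := by
  simp_rw [heatKernel_eq_const_mul]
  rw [integral_const_mul, GaussianFourier.integral_rexp_neg_mul_sq_norm (by positivity),
    finrank_euclideanSpace_fin, show Real.pi / (1 / (4 * t)) = 4 * Real.pi * t by field_simp,
    neg_div, Real.rpow_neg (by positivity)]
  exact inv_mul_cancel₀ (by positivity)

theorem integrable_heatKernel {t : ℝ} (ht : 0 < t) :
    Integrable (fun y : EuclideanSpace ℝ (Fin d) => heatKernel t y) :=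
  Integrable.of_integral_ne_zero (by rw [integral_heatKernel ht]; exact one_ne_zero)

theorem measurable_heatKernel :
    Measurable (fun q : ℝ × EuclideanSpace ℝ (Fin d) => heatKernel q.1 q.2) := by
  unfold heatKernel
  fun_prop

theorem measurable_complexHeatKernel :
    Measurable (fun q : ℂ × EuclideanSpace ℝ (Fin d) => complexHeatKernel q.1 q.2) := by
  unfold complexHeatKernel
  fun_prop

theorem measurable_component (k : Fin d) :
    Measurable (fun y : EuclideanSpace ℝ (Fin d) => y k) :=
  (EuclideanSpace.proj k : EuclideanSpace ℝ (Fin d) →L[ℝ] ℝ).continuous.measurable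

theorem measurable_heatGrad (k : Fin d) :
    Measurable (fun q : ℂ × EuclideanSpace ℝ (Fin d) => heatGrad k q.1 q.2) := by
  have h : ∀ l : Fin d, Measurable (fun q : ℂ × EuclideanSpace ℝ (Fin d) => (q.2 l : ℂ)) :=
    fun l => Complex.measurable_ofReal.comp ((measurable_component l).comp measurable_snd)
  exact ((h k).neg.div (by fun_prop)).mul measurable_complexHeatKernel

theorem measurable_heatThird (i j k : Fin d) :
    Measurable (fun q : ℂ × EuclideanSpace ℝ (Fin d) => heatThird i j k q.1 q.2) := by
  have h : ∀ l : Fin d, Measurable (fun q : ℂ × EuclideanSpace ℝ (Fin d) => (q.2 l : ℂ)) :=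
    fun l => Complex.measurable_ofReal.comp ((measurable_component l).comp measurable_snd)
  refine Measurable.mul (Measurable.add ?_ ?_) measurable_complexHeatKernel
  · exact (((h i).mul (h j)).mul (h k)).neg.div (by fun_prop)
  · exact ((((h k).const_mul _).add ((h j).const_mul _)).add ((h i).const_mul _)).div (by fun_prop)

theorem re_pos_of_mem_ball {z : ℂ} (hz : z ∈ Metric.ball (1 : ℂ) (1 / 2)) : 1 / 2 < z.re := by
  rw [Metric.mem_ball, dist_eq_norm] at hz
  have h2 := (abs_lt.1 ((Complex.abs_re_le_norm (z - 1)).trans_lt hz)).1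
  simp at h2
  linarith

theorem norm_le_of_mem_ball {z : ℂ} (hz : z ∈ Metric.ball (1 : ℂ) (1 / 2)) : ‖z‖ ≤ 3 / 2 := by
  rw [Metric.mem_ball, dist_eq_norm] at hz
  have := norm_add_le (z - 1) 1
  rw [sub_add_cancel, norm_one] at this
  linarith

theorem le_norm_of_mem_ball {z : ℂ} (hz : z ∈ Metric.ball (1 : ℂ) (1 / 2)) : 1 / 2 ≤ ‖z‖ :=
  (re_pos_of_mem_ball hz).le.trans (Complex.re_le_norm z)

/-- On the disc `Re z > 1/2` and `|z| ≤ 3/2`, so `Re (1/z) ≥ 2/9` and the exponent is at most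
`-|y|²/(18r)`. Half of it forms the heat kernel at time `9r`; the other half is kept to absorb
polynomial factors in `y`. The 18 compares `|4πzr| ≥ 2πr` with `36πr`. -/
theorem norm_complexHeatKernel_le {z : ℂ} (hz : z ∈ Metric.ball (1 : ℂ) (1 / 2)) {r : ℝ}
    (hr : 0 < r) (y : EuclideanSpace ℝ (Fin d)) :
    ‖complexHeatKernel (z * r) y‖ ≤
      (18 : ℝ) ^ ((d : ℝ) / 2) * Real.exp (-(‖y‖ ^ 2 / (36 * r))) * heatKernel (9 * r) y := by
  have hre := re_pos_of_mem_ball hz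
  have hn := norm_le_of_mem_ball hz
  have hn' := le_norm_of_mem_ball hz
  have hpi := Real.pi_pos
  unfold complexHeatKernel heatKernel
  rw [norm_mul, Complex.norm_exp, show (-(d : ℂ) / 2) = ((-(d : ℝ) / 2 : ℝ) : ℂ) by push_cast; rfl,
    Complex.norm_cpow_real]
  have h1 : ‖(4 * Real.pi * (z * r) : ℂ)‖ ^ (-(d : ℝ) / 2) ≤
      (18 : ℝ) ^ ((d : ℝ) / 2) * (4 * Real.pi * (9 * r)) ^ (-(d : ℝ) / 2) := by
    rw [neg_div, show 4 * Real.pi * (9 * r) = 18 * (2 * Real.pi * r) by ring,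
      Real.mul_rpow (by norm_num) (by positivity), ← mul_assoc ((18 : ℝ) ^ _),
      ← Real.rpow_add (by norm_num : (0 : ℝ) < 18), add_neg_cancel, Real.rpow_zero, one_mul]
    refine Real.rpow_le_rpow_of_nonpos (by positivity) ?_ (by simp; positivity)
    simp only [norm_mul, Complex.norm_real, Complex.norm_ofNat, Real.norm_eq_abs,
      abs_of_pos hr, abs_of_pos hpi]
    nlinarith [mul_pos hpi hr]
  have h2 : (-(‖y‖ : ℂ) ^ 2 / (4 * (z * r))).re ≤
      -(‖y‖ ^ 2 / (36 * r)) + -‖y‖ ^ 2 / (4 * (9 * r)) := by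
    have e : (-(‖y‖ : ℂ) ^ 2 / (4 * (z * r))) = ((-‖y‖ ^ 2 / (4 * r) : ℝ) : ℂ) * z⁻¹ := by
      push_cast
      rw [mul_comm z, ← mul_assoc, div_mul_eq_div_div, div_eq_mul_inv _ z]
    rw [e, Complex.re_ofReal_mul, Complex.inv_re]
    have h3 : 2 / 9 ≤ z.re / Complex.normSq z := by
      rw [Complex.normSq_eq_norm_sq, div_le_div_iff₀ (by norm_num) (by positivity)]
      nlinarith
    have h4 : 0 ≤ ‖y‖ ^ 2 / (4 * r) := by positivity
    have h5 := mul_le_mul_of_nonneg_left h3 h4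
    have e2 : -(‖y‖ ^ 2 / (36 * r)) + -‖y‖ ^ 2 / (4 * (9 * r)) =
        -(‖y‖ ^ 2 / (4 * r) * (2 / 9)) := by field_simp; ring
    rw [e2, neg_div, neg_mul]
    linarith
  calc _ ≤ ((18 : ℝ) ^ ((d : ℝ) / 2) * (4 * Real.pi * (9 * r)) ^ (-(d : ℝ) / 2)) *
        Real.exp (-(‖y‖ ^ 2 / (36 * r)) + -‖y‖ ^ 2 / (4 * (9 * r))) :=
        mul_le_mul h1 (Real.exp_le_exp.2 h2) (Real.exp_nonneg _) (by positivity)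
    _ = _ := by rw [Real.exp_add]; ring

theorem mul_exp_neg_sq_le_one (w : ℝ) : w * Real.exp (-w ^ 2) ≤ 1 := by
  rw [Real.exp_neg, ← div_eq_mul_inv, div_le_one (Real.exp_pos _)]
  nlinarith [Real.add_one_le_exp (w ^ 2), sq_nonneg (w - 1)]

theorem pow_three_mul_exp_neg_sq_le_one (w : ℝ) :
    w ^ 3 * Real.exp (-w ^ 2) ≤ 1 := by
  rw [Real.exp_neg, ← div_eq_mul_inv, div_le_one (Real.exp_pos _)]
  have := Real.quadratic_le_exp_of_nonneg (sq_nonneg w)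
  nlinarith [mul_nonneg (sq_nonneg w) (sq_nonneg (w - 1)), sq_nonneg w]

theorem norm_component_le (y : EuclideanSpace ℝ (Fin d)) (k : Fin d) : ‖(y k : ℂ)‖ ≤ ‖y‖ := by
  rw [Complex.norm_real]
  exact PiLp.norm_apply_le y k

/-- The constant in the Gaussian bounds on the derivatives of the complex heat kernel. -/
noncomputable def heatConst (d : ℕ) : ℝ := 234 * (18 : ℝ) ^ ((d : ℝ) / 2)

theorem heatConst_pos (d : ℕ) : 0 < heatConst d := by unfold heatConst; positivity

/-- In the parabolic variable `w` the spare Gaussian factor is `exp (-w²)`. -/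
theorem exists_scaled_norm {r : ℝ} (hr : 0 < r) (y : EuclideanSpace ℝ (Fin d)) :
    ∃ w : ℝ, 0 ≤ w ∧ ‖y‖ = 6 * √r * w ∧ ‖y‖ ^ 2 / (36 * r) = w ^ 2 := by
  have hs : 0 < √r := Real.sqrt_pos.2 hr
  have hsq : √r ^ 2 = r := Real.sq_sqrt hr.le
  refine ⟨‖y‖ / (6 * √r), by positivity, by field_simp, ?_⟩
  rw [div_pow, mul_pow, hsq]
  norm_num

theorem half_le_norm_mul {z : ℂ} (hz : z ∈ Metric.ball (1 : ℂ) (1 / 2)) {r : ℝ}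
    (hr : 0 < r) : r / 2 ≤ ‖z * (r : ℂ)‖ := by
  rw [norm_mul, Complex.norm_real, Real.norm_eq_abs, abs_of_pos hr]
  nlinarith [le_norm_of_mem_ball hz]

theorem norm_heatGrad_le {z : ℂ} (hz : z ∈ Metric.ball (1 : ℂ) (1 / 2)) {r : ℝ}
    (hr : 0 < r) (k : Fin d) (y : EuclideanSpace ℝ (Fin d)) :
    ‖heatGrad k (z * r) y‖ ≤ heatConst d * r ^ (-(1 / 2) : ℝ) * heatKernel (9 * r) y := by
  obtain ⟨w, hw, hy, hy2⟩ := exists_scaled_norm hr y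
  have hs : 0 < √r := Real.sqrt_pos.2 hr
  have hsq : √r * √r = r := Real.mul_self_sqrt hr.le
  have hZ := half_le_norm_mul hz hr
  have h1 := norm_complexHeatKernel_le hz hr y
  have hh := heatKernel_nonneg (show 0 < 9 * r by positivity) y
  rw [hy2] at h1
  have e1 : r ^ (-(1 / 2) : ℝ) = (√r)⁻¹ := by
    rw [Real.rpow_neg hr.le, Real.sqrt_eq_rpow]
  have h2 : ‖-(y k : ℂ) / (2 * (z * r))‖ ≤ 6 * w * (√r)⁻¹ := by
    rw [norm_div, norm_neg, norm_mul, Complex.norm_ofNat]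
    calc ‖(y k : ℂ)‖ / (2 * ‖z * (r : ℂ)‖) ≤ (6 * √r * w) / (2 * (r / 2)) := by
          rw [← hy]
          have := norm_component_le y k
          gcongr
      _ = 6 * w * (√r)⁻¹ := by
          rw [mul_div_cancel₀ _ (two_ne_zero)]
          nth_rewrite 2 [← hsq]
          field_simp
  unfold heatGrad heatConst
  rw [norm_mul, e1]
  calc _ ≤ (6 * w * (√r)⁻¹) * ((18 : ℝ) ^ ((d : ℝ) / 2) * Real.exp (-w ^ 2) *
        heatKernel (9 * r) y) := by gcongr
    _ = (6 * (18 : ℝ) ^ ((d : ℝ) / 2) * (√r)⁻¹ * heatKernel (9 * r) y) *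
        (w * Real.exp (-w ^ 2)) := by ring
    _ ≤ (6 * (18 : ℝ) ^ ((d : ℝ) / 2) * (√r)⁻¹ * heatKernel (9 * r) y) * 1 := by
        gcongr
        exact mul_exp_neg_sq_le_one w
    _ ≤ _ := by
        rw [mul_one]
        gcongr
        norm_num

/-- With `|zr| ≥ r/2` and `|y| = 6√r w`, the cubic term gives `216 w³` and the linear one `18 w`,
both times `r^(-3/2)`. The spare Gaussian bounds `w³` and `w` by 1, whence 234 = 216 + 18 in
`heatConst`. -/
theorem norm_heatThird_le {z : ℂ} (hz : z ∈ Metric.ball (1 : ℂ) (1 / 2)) {r : ℝ}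
    (hr : 0 < r) (i j k : Fin d) (y : EuclideanSpace ℝ (Fin d)) :
    ‖heatThird i j k (z * r) y‖ ≤ heatConst d * r ^ (-(3 / 2) : ℝ) * heatKernel (9 * r) y := by
  obtain ⟨w, hw, hy, hy2⟩ := exists_scaled_norm hr y
  have hs : 0 < √r := Real.sqrt_pos.2 hr
  have hsq : r = √r ^ 2 := (Real.sq_sqrt hr.le).symm
  have hZ := half_le_norm_mul hz hr
  have h1 := norm_complexHeatKernel_le hz hr y
  have hh := heatKernel_nonneg (show 0 < 9 * r by positivity) y
  rw [hy2] at h1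
  have e1 : r ^ (-(3 / 2) : ℝ) = (√r ^ 3)⁻¹ := by
    rw [Real.rpow_neg hr.le, Real.sqrt_eq_rpow, ← Real.rpow_natCast, ← Real.rpow_mul hr.le]
    norm_num
  have hδ : ∀ (P : Prop) [Decidable P] (l : Fin d),
      ‖(if P then 1 else 0) * (y l : ℂ)‖ ≤ ‖y‖ := by
    intro P _ l
    split_ifs
    · rw [one_mul]
      exact norm_component_le y l
    · simp
  have h2 : ‖-((y i : ℂ) * y j * y k) / (8 * (z * r) ^ 3) + ((if i = j then 1 else 0) * (y k : ℂ) +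
    (if i = k then 1 else 0) * (y j : ℂ) + (if j = k then 1 else 0) * (y i : ℂ)) /
      (4 * (z * r) ^ 2)‖ ≤ (216 * w ^ 3 + 18 * w) * (√r ^ 3)⁻¹ := by
    refine (norm_add_le _ _).trans ?_
    rw [norm_div, norm_neg, norm_div, norm_mul, norm_mul, norm_mul, norm_mul, norm_pow, norm_pow,
      Complex.norm_ofNat, Complex.norm_ofNat]
    have h3 : ‖(if i = j then 1 else 0) * (y k : ℂ) + (if i = k then 1 else 0) * (y j : ℂ) +
        (if j = k then 1 else 0) * (y i : ℂ)‖ ≤ 3 * ‖y‖ := by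
      refine (norm_add₃_le).trans ?_
      linarith [hδ (i = j) k, hδ (i = k) j, hδ (j = k) i]
    have h4 : ‖(y i : ℂ)‖ * ‖(y j : ℂ)‖ * ‖(y k : ℂ)‖ ≤ ‖y‖ ^ 3 := by
      rw [show ‖y‖ ^ 3 = ‖y‖ * ‖y‖ * ‖y‖ by ring]
      have := norm_component_le y
      gcongr <;> exact this _
    calc _ ≤ ‖y‖ ^ 3 / (8 * (r / 2) ^ 3) + 3 * ‖y‖ / (4 * (r / 2) ^ 2) := by gcongr
      _ = (216 * w ^ 3 + 18 * w) * (√r ^ 3)⁻¹ := by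
        rw [hy]
        generalize √r = s at *
        subst hsq
        field_simp
        ring
  unfold heatThird heatConst
  rw [norm_mul, e1]
  calc _ ≤ ((216 * w ^ 3 + 18 * w) * (√r ^ 3)⁻¹) * ((18 : ℝ) ^ ((d : ℝ) / 2) * Real.exp (-w ^ 2) *
        heatKernel (9 * r) y) := by gcongr
    _ = ((18 : ℝ) ^ ((d : ℝ) / 2) * (√r ^ 3)⁻¹ * heatKernel (9 * r) y) *
        (216 * (w ^ 3 * Real.exp (-w ^ 2)) + 18 * (w * Real.exp (-w ^ 2))) := by ring
    _ ≤ ((18 : ℝ) ^ ((d : ℝ) / 2) * (√r ^ 3)⁻¹ * heatKernel (9 * r) y) * (216 * 1 + 18 * 1) := by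
        gcongr
        · exact pow_three_mul_exp_neg_sq_le_one w
        · exact mul_exp_neg_sq_le_one w
    _ = _ := by ring

theorem differentiableOn_complexHeatKernel {r : ℝ} (hr : 0 < r) (y : EuclideanSpace ℝ (Fin d)) :
    DifferentiableOn ℂ (fun z : ℂ => complexHeatKernel (z * r) y) (Metric.ball 1 (1 / 2)) := by
  intro z hz
  have hre := re_pos_of_mem_ball hz
  have hz0 : z ≠ 0 := fun h => by simp [h] at hre; linarith
  have hr0 : (r : ℂ) ≠ 0 := Complex.ofReal_ne_zero.2 hr.ne'
  refine DifferentiableAt.differentiableWithinAt ?_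
  unfold complexHeatKernel
  refine DifferentiableAt.mul (DifferentiableAt.cpow (by fun_prop) (by fun_prop) (Or.inl ?_))
    (DifferentiableAt.cexp (DifferentiableAt.div (by fun_prop) (by fun_prop) (by simp [hz0, hr0])))
  rw [show (4 * Real.pi * (z * r) : ℂ) = ((4 * Real.pi * r : ℝ) : ℂ) * z by push_cast; ring,
    Complex.re_ofReal_mul]
  have := Real.pi_pos
  positivity

theorem differentiableOn_heatGrad {r : ℝ} (hr : 0 < r) (k : Fin d)
    (y : EuclideanSpace ℝ (Fin d)) :
    DifferentiableOn ℂ (fun z : ℂ => heatGrad k (z * r) y) (Metric.ball 1 (1 / 2)) := by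
  refine DifferentiableOn.mul (fun z hz => ?_) (differentiableOn_complexHeatKernel hr y)
  have hre := re_pos_of_mem_ball hz
  have hz0 : z ≠ 0 := fun h => by simp [h] at hre; linarith
  have hr0 : (r : ℂ) ≠ 0 := Complex.ofReal_ne_zero.2 hr.ne'
  exact (DifferentiableAt.div (by fun_prop) (by fun_prop)
    (by simp [hz0, hr0])).differentiableWithinAt

theorem differentiableOn_heatThird {r : ℝ} (hr : 0 < r) (i j k : Fin d)
    (y : EuclideanSpace ℝ (Fin d)) :
    DifferentiableOn ℂ (fun z : ℂ => heatThird i j k (z * r) y) (Metric.ball 1 (1 / 2)) := by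
  refine DifferentiableOn.mul (fun z hz => ?_) (differentiableOn_complexHeatKernel hr y)
  have hre := re_pos_of_mem_ball hz
  have hz0 : z ≠ 0 := fun h => by simp [h] at hre; linarith
  have hr0 : (r : ℂ) ≠ 0 := Complex.ofReal_ne_zero.2 hr.ne'
  exact (DifferentiableAt.add (DifferentiableAt.div (by fun_prop) (by fun_prop)
    (by simp [hz0, hr0])) (DifferentiableAt.div (by fun_prop) (by fun_prop)
    (by simp [hz0, hr0]))).differentiableWithinAt

end Bounds

/-! ### The dilated Oseen kernel and the caloric extension at complex dilation. -/

/-- `z` times the derivative `∂_k E_{ij}` of the Stokes-Oseen kernel at the complex time `z t`,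
for `0 < t < 1`. -/
noncomputable def dilatedStokes {d : ℕ} (i j k : Fin d) (z : ℂ) (q : SpaceTime d) : ℂ :=
  (Ioo (0 : ℝ) 1 ×ˢ univ).indicator (fun q : SpaceTime d =>
    -- The outer `z` is the Jacobian of the dilation in the Duhamel integral; the inner one is that
    -- of `r ↦ z r` in the pressure integral, which keeps the domain of integration real.
    z * ((if i = j then 1 else 0) * heatGrad k (z * q.1) q.2 +
      z * ∫ r in Ioi q.1, heatThird i j k (z * r) q.2)) q

/-- The integrable majorant of `dilatedStokes`. -/
noncomputable def stokesMajorant {d : ℕ} (q : SpaceTime d) : ℝ :=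
  (Ioo (0 : ℝ) 1 ×ˢ univ).indicator (fun q : SpaceTime d =>
    -- The 4 bounds the two factors `z`, each of modulus at most 2.
    4 * heatConst d * (q.1 ^ (-(1 / 2) : ℝ) * heatKernel (9 * q.1) q.2 +
      ∫ r in Ioi q.1, r ^ (-(3 / 2) : ℝ) * heatKernel (9 * r) q.2)) q

/-- The caloric extension of `u₀`, at complex times. -/
noncomputable def freeTerm {d : ℕ} (u₀ : EuclideanSpace ℝ (Fin d) → Fin d → ℂ) (z : ℂ) (i : Fin d)
    (p : SpaceTime d) : ℂ :=
  ∫ y, complexHeatKernel (z * p.1) (p.2 - y) * u₀ y i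

section Kernel

variable {d : ℕ}

theorem measurable_integral_Ioi {F : Type*} [NormedAddCommGroup F] [NormedSpace ℝ F]
    [CompleteSpace F] [MeasurableSpace F] [BorelSpace F] [SecondCountableTopology F]
    {G : ℝ × EuclideanSpace ℝ (Fin d) → F} (hG : Measurable G) :
    Measurable (fun q : SpaceTime d => ∫ r in Ioi q.1, G (r, q.2)) := by
  simp_rw [← integral_indicator (measurableSet_Ioi)]
  refine StronglyMeasurable.measurable (StronglyMeasurable.integral_prod_right
    (f := fun (q : SpaceTime d) (r : ℝ) => (Ioi q.1).indicator (fun r => G (r, q.2)) r) ?_)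
  refine Measurable.stronglyMeasurable ?_
  have hs : MeasurableSet {x : SpaceTime d × ℝ | x.1.1 < x.2} :=
    measurableSet_lt (measurable_fst.comp measurable_fst) measurable_snd
  exact Measurable.indicator (hG.comp (measurable_snd.prodMk
    (measurable_snd.comp measurable_fst))) hs

theorem measurable_rpow_mul_heatKernel (α : ℝ) :
    Measurable (fun q : ℝ × EuclideanSpace ℝ (Fin d) =>
      q.1 ^ α * heatKernel (9 * q.1) q.2) :=
  (measurable_fst.pow_const _).mul
    (measurable_heatKernel.comp ((measurable_fst.const_mul 9).prodMk measurable_snd))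

theorem integrable_mul_heatKernel {μ : Measure ℝ} [SFinite μ] {m : ℝ → ℝ} (hm : Integrable m μ)
    (hpos : ∀ᵐ r ∂μ, 0 < r) :
    Integrable (fun q : ℝ × EuclideanSpace ℝ (Fin d) => m q.1 * heatKernel (9 * q.1) q.2)
      (μ.prod volume) := by
  have hmeas : AEStronglyMeasurable (fun q : ℝ × EuclideanSpace ℝ (Fin d) =>
      m q.1 * heatKernel (9 * q.1) q.2) (μ.prod volume) :=
    hm.1.comp_fst.mul (measurable_heatKernel.comp
      ((measurable_fst.const_mul 9).prodMk measurable_snd)).aestronglyMeasurable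
  refine (integrable_prod_iff hmeas).2 ⟨?_, hm.norm.congr ?_⟩
  · filter_upwards [hpos] with r hr
    exact (integrable_heatKernel (by positivity)).const_mul _
  · filter_upwards [hpos] with r hr
    have : ∀ y : EuclideanSpace ℝ (Fin d), ‖m r * heatKernel (9 * r) y‖ =
        ‖m r‖ * heatKernel (9 * r) y := fun y => by
      rw [norm_mul, Real.norm_of_nonneg (heatKernel_nonneg (by positivity) y)]
    simp_rw [this]
    rw [integral_const_mul, integral_heatKernel (by positivity), mul_one]

theorem integrableOn_Ioi_rpow_mul_heatKernel {τ : ℝ} (hτ : 0 < τ) :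
    Integrable (fun q : ℝ × EuclideanSpace ℝ (Fin d) =>
      q.1 ^ (-(3 / 2) : ℝ) * heatKernel (9 * q.1) q.2)
      ((volume.restrict (Ioi τ)).prod volume) := by
  refine integrable_mul_heatKernel (m := fun r => r ^ (-(3 / 2) : ℝ))
    (integrableOn_Ioi_rpow_of_lt (by norm_num) hτ) ?_
  filter_upwards [ae_restrict_mem measurableSet_Ioi] with r hr using hτ.trans hr

theorem integral_rpow_mul_heatKernel_nonneg {τ : ℝ} (hτ : 0 < τ)
    (y : EuclideanSpace ℝ (Fin d)) :
    0 ≤ ∫ r in Ioi τ, r ^ (-(3 / 2) : ℝ) * heatKernel (9 * r) y := by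
  refine setIntegral_nonneg measurableSet_Ioi fun r hr => ?_
  have hr0 : 0 < r := hτ.trans hr
  have := heatKernel_nonneg (show 0 < 9 * r by positivity) y
  positivity

/-- The heat kernel has mass 1, so integrating first in space leaves `∫_τ^∞ r^(-3/2) dr = 2
τ^(-1/2)`, which is integrable on `(0,1)`. -/
theorem integrable_integral_rpow_mul_heatKernel :
    Integrable (fun q : ℝ × EuclideanSpace ℝ (Fin d) =>
      ∫ r in Ioi q.1, r ^ (-(3 / 2) : ℝ) * heatKernel (9 * r) q.2)
      ((volume.restrict (Ioo 0 1)).prod volume) := by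
  have hmeas := measurable_integral_Ioi
    (measurable_rpow_mul_heatKernel (d := d) (-(3 / 2) : ℝ))
  refine (integrable_prod_iff hmeas.aestronglyMeasurable).2 ⟨?_, ?_⟩
  · filter_upwards [ae_restrict_mem measurableSet_Ioo] with τ hτ
    exact (integrableOn_Ioi_rpow_mul_heatKernel hτ.1).integral_prod_right
  · have h0 : IntegrableOn (fun τ : ℝ => 2 * τ ^ (-(1 / 2) : ℝ)) (Ioo 0 1) :=
      ((intervalIntegral.integrableOn_Ioo_rpow_iff one_pos).2 (by norm_num)).const_mul 2
    refine Integrable.congr h0 ?_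
    filter_upwards [ae_restrict_mem measurableSet_Ioo] with τ hτ
    simp_rw [Real.norm_of_nonneg (integral_rpow_mul_heatKernel_nonneg hτ.1 _)]
    rw [← integral_integral_swap (f := fun r (y : EuclideanSpace ℝ (Fin d)) =>
      r ^ (-(3 / 2) : ℝ) * heatKernel (9 * r) y) (integrableOn_Ioi_rpow_mul_heatKernel hτ.1)]
    rw [setIntegral_congr_fun (g := fun r => r ^ (-(3 / 2) : ℝ)) measurableSet_Ioi,
      integral_Ioi_rpow_of_lt (by norm_num) hτ.1]
    · norm_num
      ring
    · intro r hr
      have hr0 : 0 < r := hτ.1.trans hr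
      simp only
      rw [integral_const_mul, integral_heatKernel (by positivity), mul_one]

theorem integrable_stokesMajorant : Integrable (stokesMajorant (d := d)) := by
  have hS : MeasurableSet (Ioo (0 : ℝ) 1 ×ˢ (univ : Set (EuclideanSpace ℝ (Fin d)))) :=
    measurableSet_Ioo.prod MeasurableSet.univ
  unfold stokesMajorant
  change Integrable (indicator _ _) volume
  rw [integrable_indicator_iff hS, IntegrableOn, Measure.volume_eq_prod, ← Measure.prod_restrict,
    Measure.restrict_univ]
  refine Integrable.const_mul (Integrable.add ?_ integrable_integral_rpow_mul_heatKernel) _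
  refine integrable_mul_heatKernel (m := fun r => r ^ (-(1 / 2) : ℝ))
    ((intervalIntegral.integrableOn_Ioo_rpow_iff one_pos).2 (by norm_num)) ?_
  filter_upwards [ae_restrict_mem measurableSet_Ioo] with r hr using hr.1

theorem measurable_dilation (z : ℂ) :
    Measurable (fun q : ℝ × EuclideanSpace ℝ (Fin d) => ((z * q.1 : ℂ), q.2)) :=
  ((Complex.measurable_ofReal.comp measurable_fst).const_mul z).prodMk measurable_snd

theorem measurable_heatThird_dilated (i j k : Fin d) (z : ℂ) :
    Measurable (fun q : ℝ × EuclideanSpace ℝ (Fin d) => heatThird i j k (z * q.1) q.2) := by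
  have := (measurable_heatThird i j k).comp (measurable_dilation (d := d) z)
  exact this

theorem measurable_heatGrad_dilated (k : Fin d) (z : ℂ) :
    Measurable (fun q : ℝ × EuclideanSpace ℝ (Fin d) => heatGrad k (z * q.1) q.2) := by
  have := (measurable_heatGrad k).comp (measurable_dilation (d := d) z)
  exact this

theorem measurable_dilatedStokes (i j k : Fin d) (z : ℂ) :
    Measurable (dilatedStokes i j k z) :=
  Measurable.indicator ((((measurable_heatGrad_dilated k z).const_mul _).add
    ((measurable_integral_Ioi (measurable_heatThird_dilated i j k z)).const_mul z)).const_mul z)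
    (measurableSet_Ioo.prod MeasurableSet.univ)

/-- Fixing `y`, the Gaussian majorant is integrable in time away from zero. -/
theorem integrableOn_rpow_mul_heatKernel_time {τ : ℝ} (hτ : 0 < τ)
    (y : EuclideanSpace ℝ (Fin d)) :
    IntegrableOn (fun r => r ^ (-(3 / 2) : ℝ) * heatKernel (9 * r) y) (Ioi τ) := by
  have h0 : IntegrableOn (fun r : ℝ => r ^ (-(3 / 2) : ℝ) *
      (4 * Real.pi * (9 * τ)) ^ (-(d : ℝ) / 2)) (Ioi τ) :=
    (integrableOn_Ioi_rpow_of_lt (by norm_num) hτ).mul_const _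
  refine Integrable.mono' h0 ?_ ?_
  · exact ((measurable_rpow_mul_heatKernel (d := d) _).comp
      (measurable_id.prodMk measurable_const)).aestronglyMeasurable
  · filter_upwards [ae_restrict_mem measurableSet_Ioi] with r hr
    have hr0 : 0 < r := hτ.trans hr
    have h1 := heatKernel_nonneg (show 0 < 9 * r by positivity) y
    rw [Real.norm_of_nonneg (by positivity)]
    gcongr
    unfold heatKernel
    refine (mul_le_of_le_one_right (by positivity) (Real.exp_le_one_iff.2 ?_)).trans ?_
    · rw [neg_div]
      exact neg_nonpos.2 (by positivity)
    · refine Real.rpow_le_rpow_of_nonpos (by positivity) ?_ ?_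
      · have := hr.out.le
        gcongr
      · rw [neg_div]
        exact neg_nonpos.2 (by positivity)

theorem norm_integral_heatThird_le {z : ℂ} (hz : z ∈ Metric.ball (1 : ℂ) (1 / 2)) {τ : ℝ}
    (hτ : 0 < τ) (i j k : Fin d) (y : EuclideanSpace ℝ (Fin d)) :
    ‖∫ r in Ioi τ, heatThird i j k (z * r) y‖ ≤
      heatConst d * ∫ r in Ioi τ, r ^ (-(3 / 2) : ℝ) * heatKernel (9 * r) y := by
  rw [← integral_const_mul]
  refine norm_integral_le_of_norm_le ((integrableOn_rpow_mul_heatKernel_time hτ y).const_mul _) ?_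
  filter_upwards [ae_restrict_mem measurableSet_Ioi] with r hr
  rw [← mul_assoc]
  exact norm_heatThird_le hz (hτ.trans hr) i j k y

theorem stokesMajorant_nonneg (q : SpaceTime d) : 0 ≤ stokesMajorant q := by
  refine indicator_nonneg (fun q hq => ?_) q
  have h0 : 0 < q.1 := hq.1.1
  have h1 := integral_rpow_mul_heatKernel_nonneg h0 q.2
  have h2 := heatKernel_nonneg (show 0 < 9 * q.1 by positivity) q.2
  have := heatConst_pos d
  positivity

theorem norm_dilatedStokes_le (i j k : Fin d) {z : ℂ} (hz : z ∈ Metric.ball (1 : ℂ) (1 / 2))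
    (q : SpaceTime d) : ‖dilatedStokes i j k z q‖ ≤ stokesMajorant q := by
  unfold dilatedStokes stokesMajorant
  by_cases hq : q ∈ Ioo (0 : ℝ) 1 ×ˢ (univ : Set (EuclideanSpace ℝ (Fin d)))
  · rw [indicator_of_mem hq, indicator_of_mem hq]
    have h0 : 0 < q.1 := hq.1.1
    have h1 := integral_rpow_mul_heatKernel_nonneg h0 q.2
    have h2 := heatKernel_nonneg (show 0 < 9 * q.1 by positivity) q.2
    have hc := heatConst_pos d
    have hz2 : ‖z‖ ≤ 2 := (norm_le_of_mem_ball hz).trans (by norm_num)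
    have h3 := norm_heatGrad_le hz h0 k q.2
    have h4 := norm_integral_heatThird_le hz h0 i j k q.2
    have hA : 0 ≤ heatConst d * q.1 ^ (-(1 / 2) : ℝ) * heatKernel (9 * q.1) q.2 := by positivity
    have h5 : ‖(if i = j then 1 else 0) * heatGrad k (z * q.1) q.2‖ ≤
        heatConst d * q.1 ^ (-(1 / 2) : ℝ) * heatKernel (9 * q.1) q.2 := by
      split_ifs
      · rwa [one_mul]
      · simpa using hA
    rw [norm_mul]
    calc _ ≤ 2 * (heatConst d * q.1 ^ (-(1 / 2) : ℝ) * heatKernel (9 * q.1) q.2 +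
          2 * (heatConst d * ∫ r in Ioi q.1, r ^ (-(3 / 2) : ℝ) * heatKernel (9 * r) q.2)) := by
          refine mul_le_mul hz2 ((norm_add_le _ _).trans (add_le_add h5 ?_)) (norm_nonneg _)
            (by norm_num)
          rw [norm_mul]
          gcongr
      _ ≤ _ := by linarith
  · rw [indicator_of_notMem hq, indicator_of_notMem hq, norm_zero]

theorem differentiableOn_dilatedStokes (i j k : Fin d) (q : SpaceTime d) :
    DifferentiableOn ℂ (fun z => dilatedStokes i j k z q) (Metric.ball 1 (1 / 2)) := by
  unfold dilatedStokes
  by_cases hq : q ∈ Ioo (0 : ℝ) 1 ×ˢ (univ : Set (EuclideanSpace ℝ (Fin d)))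
  · simp only [indicator_of_mem hq]
    have h0 : 0 < q.1 := hq.1.1
    refine differentiableOn_id.mul (((differentiableOn_heatGrad h0 k q.2).const_mul _).add
      (differentiableOn_id.mul ?_))
    refine differentiableOn_integral_of_dominated Metric.isOpen_ball
      (g := fun r => heatConst d * (r ^ (-(3 / 2) : ℝ) * heatKernel (9 * r) q.2))
      (fun z _ => ?_) ?_ ((integrableOn_rpow_mul_heatKernel_time h0 q.2).const_mul _) ?_
    · exact ((measurable_heatThird_dilated i j k z).comp
        (measurable_id.prodMk measurable_const)).aestronglyMeasurable
    · filter_upwards [ae_restrict_mem measurableSet_Ioi] with r hr z hz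
      rw [← mul_assoc]
      exact norm_heatThird_le hz (h0.trans hr) i j k q.2
    · filter_upwards [ae_restrict_mem measurableSet_Ioi] with r hr
      exact differentiableOn_heatThird (h0.trans hr) i j k q.2
  · simp only [indicator_of_notMem hq]
    exact differentiableOn_const _

theorem isDominatedKernel_dilatedStokes :
    IsDominatedKernel (dilatedStokes (d := d)) (1 / 2) stokesMajorant where
  differentiableOn := differentiableOn_dilatedStokes
  measurable i j k z _ := measurable_dilatedStokes i j k z
  norm_le i j k _ hz q := norm_dilatedStokes_le i j k hz q
  integrable := integrable_stokesMajorant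
  nonneg := stokesMajorant_nonneg
  causal _ hq := indicator_of_notMem (fun h => not_lt.2 hq h.1.1) _

theorem norm_complexHeatKernel_le_heatKernel {z : ℂ} (hz : z ∈ Metric.ball (1 : ℂ) (1 / 2))
    {r : ℝ} (hr : 0 < r) (y : EuclideanSpace ℝ (Fin d)) :
    ‖complexHeatKernel (z * r) y‖ ≤ (18 : ℝ) ^ ((d : ℝ) / 2) * heatKernel (9 * r) y := by
  refine (norm_complexHeatKernel_le hz hr y).trans ?_
  have := heatKernel_nonneg (show 0 < 9 * r by positivity) y
  gcongr
  exact mul_le_of_le_one_right (by positivity)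
    (Real.exp_le_one_iff.2 (neg_nonpos.2 (by positivity)))

section FreeTerm

variable {u₀ : EuclideanSpace ℝ (Fin d) → Fin d → ℂ} {C : ℝ}

theorem measurable_freeTerm (hu : Measurable u₀) (z : ℂ) (i : Fin d) :
    Measurable (freeTerm u₀ z i) := by
  refine StronglyMeasurable.measurable (StronglyMeasurable.integral_prod_right
    (f := fun (p : SpaceTime d) y => complexHeatKernel (z * p.1) (p.2 - y) * u₀ y i) ?_)
  refine Measurable.stronglyMeasurable (Measurable.mul ?_ ?_)
  · have h : Measurable (fun q : SpaceTime d × EuclideanSpace ℝ (Fin d) =>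
        (q.1.1, q.1.2 - q.2)) :=
      (measurable_fst.comp measurable_fst).prodMk
        ((measurable_snd.comp measurable_fst).sub measurable_snd)
    have := measurable_complexHeatKernel.comp ((measurable_dilation (d := d) z).comp h)
    exact this
  · exact (measurable_pi_apply i).comp (hu.comp measurable_snd)

theorem norm_freeTerm_integrand_le (hC : ∀ y, ‖u₀ y‖ ≤ C) {z : ℂ}
    (hz : z ∈ Metric.ball (1 : ℂ) (1 / 2)) (i : Fin d) {p : SpaceTime d} (hp : 0 < p.1)
    (y : EuclideanSpace ℝ (Fin d)) :
    ‖complexHeatKernel (z * p.1) (p.2 - y) * u₀ y i‖ ≤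
      (18 : ℝ) ^ ((d : ℝ) / 2) * heatKernel (9 * p.1) (p.2 - y) * C := by
  rw [norm_mul]
  have h1 := norm_complexHeatKernel_le_heatKernel hz hp (p.2 - y)
  exact mul_le_mul h1 ((norm_le_pi_norm _ _).trans (hC y)) (norm_nonneg _)
    ((norm_nonneg _).trans h1)

theorem integrable_freeTerm_majorant {p : SpaceTime d} (hp : 0 < p.1) :
    Integrable (fun y => (18 : ℝ) ^ ((d : ℝ) / 2) * heatKernel (9 * p.1) (p.2 - y) * C) :=
  (((integrable_heatKernel (by positivity)).comp_sub_left p.2).const_mul _).mul_const _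

theorem norm_freeTerm_le (hC : ∀ y, ‖u₀ y‖ ≤ C) {z : ℂ}
    (hz : z ∈ Metric.ball (1 : ℂ) (1 / 2)) (i : Fin d) {p : SpaceTime d} (hp : 0 < p.1) :
    ‖freeTerm u₀ z i p‖ ≤ (18 : ℝ) ^ ((d : ℝ) / 2) * C := by
  refine (norm_integral_le_of_norm_le (integrable_freeTerm_majorant hp)
    (Filter.Eventually.of_forall (norm_freeTerm_integrand_le hC hz i hp))).trans_eq ?_
  rw [integral_mul_const, integral_const_mul,
    integral_sub_left_eq_self (fun y => heatKernel (9 * p.1) y) volume p.2,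
    integral_heatKernel (by positivity), mul_one]

theorem differentiableOn_freeTerm (hu : Measurable u₀) (hC : ∀ y, ‖u₀ y‖ ≤ C) (i : Fin d)
    {p : SpaceTime d} (hp : 0 < p.1) :
    DifferentiableOn ℂ (fun z => freeTerm u₀ z i p) (Metric.ball 1 (1 / 2)) := by
  refine differentiableOn_integral_of_dominated Metric.isOpen_ball (fun z _ => ?_)
    (Filter.Eventually.of_forall fun y z hz => norm_freeTerm_integrand_le hC hz i hp y)
    (integrable_freeTerm_majorant hp) (Filter.Eventually.of_forall fun y => ?_)
  · refine Measurable.aestronglyMeasurable (Measurable.mul ?_ ((measurable_pi_apply i).comp hu))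
    have h : Measurable (fun y : EuclideanSpace ℝ (Fin d) => (z * (p.1 : ℂ), p.2 - y)) :=
      measurable_const.prodMk (measurable_const.sub measurable_id)
    have := measurable_complexHeatKernel.comp h
    exact this
  · exact (differentiableOn_complexHeatKernel hp _).mul_const _

end FreeTerm

end Kernel

/-! ### Fourier transforms of the heat kernel and of its spatial derivatives. -/

section Fourier

open scoped RealInnerProductSpace

theorem exists_hasFDerivAt_fourierInv {V : Type*} [NormedAddCommGroup V] [InnerProductSpace ℝ V]
    [FiniteDimensional ℝ V] [MeasurableSpace V] [BorelSpace V] {f : V → ℂ} (hf : Integrable f)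
    (hvf : Integrable (fun v => ‖v‖ * ‖f v‖)) (x e : V) :
    ∃ L : V →L[ℝ] ℂ, HasFDerivAt (𝓕⁻ f) L x ∧
      L e = 𝓕⁻ (fun ξ => 2 * Real.pi * Complex.I * (⟪ξ, e⟫ : ℂ) * f ξ) x := by
  have h1 := HasFDerivAt.comp (f := fun y : V => -y) x (Real.hasFDerivAt_fourier hf hvf (-x))
    (hasFDerivAt_id x).neg
  have h2 : 𝓕⁻ f = 𝓕 f ∘ fun y : V => -y := funext fun y => Real.fourierInv_eq_fourier_neg f y
  have hint : Integrable (VectorFourier.fourierSMulRight (innerSL ℝ) f) := by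
    refine (hvf.const_mul (2 * Real.pi * ‖innerSL ℝ (E := V)‖)).mono'
      hf.1.fourierSMulRight (Filter.Eventually.of_forall fun v => ?_)
    refine (VectorFourier.norm_fourierSMulRight_le (innerSL ℝ) f v).trans_eq ?_
    ring
  refine ⟨_, h2 ▸ h1, ?_⟩
  have h3 : (𝓕 (VectorFourier.fourierSMulRight (innerSL ℝ) f) (-x)) (-e) =
      𝓕 (fun ξ => VectorFourier.fourierSMulRight (innerSL ℝ) f ξ (-e)) (-x) :=
    Real.fourier_continuousLinearMap_apply hint
  change (𝓕 (VectorFourier.fourierSMulRight (innerSL ℝ) f) (-x)) (-e) = _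
  rw [h3, Real.fourierInv_eq_fourier_neg]
  refine congrArg (fun g : V → ℂ => 𝓕 g (-x)) (funext fun ξ => ?_)
  simp
  rw [innerSL_apply_apply]
  ring

/-- Uniqueness of derivatives: once `𝓕⁻ f` is known in closed form, multiplying the symbol by
`2πi⟨ξ,e⟩` amounts to differentiating that closed form along a line. Three applications lead from
the heat kernel to its third derivatives. -/
theorem fourierInv_inner_mul_eq {V : Type*} [NormedAddCommGroup V] [InnerProductSpace ℝ V]
    [FiniteDimensional ℝ V] [MeasurableSpace V] [BorelSpace V] {f F : V → ℂ} (hf : Integrable f)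
    (hvf : Integrable (fun v => ‖v‖ * ‖f v‖)) (hF : ∀ x, 𝓕⁻ f x = F x) {x e : V} {c : ℂ}
    (hc : HasDerivAt (fun s : ℝ => F (x + s • e)) c 0) :
    𝓕⁻ (fun ξ => 2 * Real.pi * Complex.I * (⟪ξ, e⟫ : ℂ) * f ξ) x = c := by
  obtain ⟨L, hL, hLe⟩ := exists_hasFDerivAt_fourierInv hf hvf x e
  rw [← hLe]
  have h1 : HasDerivAt (fun s : ℝ => x + s • e) e 0 := by
    simpa using ((hasDerivAt_id (0 : ℝ)).smul_const e).const_add x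
  have h2 : HasDerivAt (fun s : ℝ => 𝓕⁻ f (x + s • e)) (L e) 0 :=
    HasFDerivAt.comp_hasDerivAt (0 : ℝ) (by simpa using hL) h1
  simp_rw [hF] at h2
  exact h2.unique hc

/-- From `|ξ|ⁿ ≤ n! exp |ξ|` and, by completing the square, `|ξ| ≤ 1/(2b) + b|ξ|²/2`, half of the
Gaussian remains as a majorant. -/
theorem integrable_norm_pow_mul_exp {V : Type*} [NormedAddCommGroup V] [InnerProductSpace ℝ V]
    [FiniteDimensional ℝ V] [MeasurableSpace V] [BorelSpace V] (n : ℕ) {b : ℝ} (hb : 0 < b) :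
    Integrable (fun ξ : V => ‖ξ‖ ^ n * Real.exp (-b * ‖ξ‖ ^ 2)) := by
  have h0 : Integrable (fun ξ : V => (n.factorial : ℝ) * Real.exp (1 / (2 * b)) *
      Real.exp (-(b / 2) * ‖ξ‖ ^ 2)) := by
    refine Integrable.const_mul (Integrable.of_integral_ne_zero ?_) _
    rw [GaussianFourier.integral_rexp_neg_mul_sq_norm (by positivity)]
    have := Real.pi_pos
    positivity
  refine h0.mono' (Continuous.aestronglyMeasurable (by fun_prop))
    (Filter.Eventually.of_forall fun ξ => ?_)
  rw [Real.norm_of_nonneg (by positivity), mul_assoc, ← Real.exp_add]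
  have h1 := (div_le_iff₀ (by positivity)).1
    (Real.pow_div_factorial_le_exp ‖ξ‖ (norm_nonneg ξ) n)
  calc ‖ξ‖ ^ n * Real.exp (-b * ‖ξ‖ ^ 2)
      ≤ (Real.exp ‖ξ‖ * n.factorial) * Real.exp (-b * ‖ξ‖ ^ 2) := by gcongr
    _ = n.factorial * Real.exp (‖ξ‖ + -b * ‖ξ‖ ^ 2) := by rw [Real.exp_add]; ring
    _ ≤ _ := by
      refine mul_le_mul_of_nonneg_left (Real.exp_le_exp.2 ?_) (by positivity)
      have h2 : 1 / (2 * b) - ‖ξ‖ + b / 2 * ‖ξ‖ ^ 2 = (b * ‖ξ‖ - 1) ^ 2 / (2 * b) := by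
        field_simp
        ring
      have h3 : 0 ≤ (b * ‖ξ‖ - 1) ^ 2 / (2 * b) := by positivity
      linarith

variable {d : ℕ}

/-- The Fourier transform of the heat kernel. -/
noncomputable def heatSymbol {d : ℕ} (t : ℝ) (ξ : EuclideanSpace ℝ (Fin d)) : ℂ :=
  (Real.exp (-(4 * Real.pi ^ 2 * t) * ‖ξ‖ ^ 2) : ℝ)

theorem norm_heatSymbol (t : ℝ) (ξ : EuclideanSpace ℝ (Fin d)) :
    ‖heatSymbol t ξ‖ = Real.exp (-(4 * Real.pi ^ 2 * t) * ‖ξ‖ ^ 2) := by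
  rw [heatSymbol, Complex.norm_real, Real.norm_of_nonneg (Real.exp_nonneg _)]

theorem measurable_heatSymbol :
    Measurable (fun q : ℝ × EuclideanSpace ℝ (Fin d) => heatSymbol q.1 q.2) := by
  unfold heatSymbol
  fun_prop

theorem integrable_mul_heatSymbol {t : ℝ} (ht : 0 < t) {P : EuclideanSpace ℝ (Fin d) → ℂ}
    (hP : Measurable P) {c : ℝ} {n : ℕ} (hb : ∀ ξ, ‖P ξ‖ ≤ c * ‖ξ‖ ^ n) :
    Integrable (fun ξ => P ξ * heatSymbol t ξ) := by
  refine ((integrable_norm_pow_mul_exp (V := EuclideanSpace ℝ (Fin d)) n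
    (show 0 < 4 * Real.pi ^ 2 * t by positivity)).const_mul c).mono' ?_
    (Filter.Eventually.of_forall fun ξ => ?_)
  · exact (hP.mul (measurable_heatSymbol.comp
      (measurable_const.prodMk measurable_id))).aestronglyMeasurable
  · rw [norm_mul, norm_heatSymbol, ← mul_assoc]
    exact mul_le_mul_of_nonneg_right (hb ξ) (Real.exp_nonneg _)

theorem integrable_norm_mul_heatSymbol {t : ℝ} (ht : 0 < t) {P : EuclideanSpace ℝ (Fin d) → ℂ}
    (hP : Measurable P) {c : ℝ} {n : ℕ} (hb : ∀ ξ, ‖P ξ‖ ≤ c * ‖ξ‖ ^ n) :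
    Integrable (fun ξ => ‖ξ‖ * ‖P ξ * heatSymbol t ξ‖) := by
  have hm : Measurable (fun ξ : EuclideanSpace ℝ (Fin d) => ((‖ξ‖ : ℝ) : ℂ) * P ξ) :=
    (Complex.measurable_ofReal.comp measurable_norm).mul hP
  refine (integrable_mul_heatSymbol ht hm (c := c) (n := n + 1) fun ξ => ?_).norm.congr
    (Filter.Eventually.of_forall fun ξ => ?_)
  · rw [norm_mul, Complex.norm_real, norm_norm, pow_succ]
    nlinarith [hb ξ, norm_nonneg ξ]
  · simp only [norm_mul, Complex.norm_real, norm_norm, mul_assoc]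

theorem fourier_heatKernel {t : ℝ} (ht : 0 < t) (ξ : EuclideanSpace ℝ (Fin d)) :
    𝓕 (fun y : EuclideanSpace ℝ (Fin d) => (heatKernel t y : ℂ)) ξ = heatSymbol t ξ := by
  have hb : 0 < ((1 / (4 * t) : ℝ) : ℂ).re := by simpa using ht
  have h1 := fourier_gaussian_innerProductSpace hb ξ
  have h2 : ∀ y : EuclideanSpace ℝ (Fin d), (heatKernel t y : ℂ) =
      (((4 * Real.pi * t) ^ (-(d : ℝ) / 2) : ℝ) : ℂ) *
        Complex.exp (-((1 / (4 * t) : ℝ) : ℂ) * ‖y‖ ^ 2) := by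
    intro y
    rw [heatKernel_eq_const_mul]
    push_cast
    rfl
  rw [Real.fourier_eq'] at h1 ⊢
  simp only [smul_eq_mul] at h1 ⊢
  simp_rw [h2, mul_left_comm _ (((4 * Real.pi * t) ^ (-(d : ℝ) / 2) : ℝ) : ℂ)]
  rw [integral_const_mul, h1, finrank_euclideanSpace_fin]
  have e1 : ((Real.pi : ℂ) / ((1 / (4 * t) : ℝ) : ℂ)) ^ ((d : ℂ) / 2) =
      (((4 * Real.pi * t) ^ ((d : ℝ) / 2) : ℝ) : ℂ) := by
    rw [Complex.ofReal_cpow (by positivity)]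
    push_cast
    congr 1
    field_simp
  rw [e1, ← mul_assoc, ← Complex.ofReal_mul, ← Real.rpow_add (by positivity), neg_div,
    neg_add_cancel, Real.rpow_zero, Complex.ofReal_one, one_mul, heatSymbol, Complex.ofReal_exp]
  congr 1
  push_cast
  have : (t : ℂ) ≠ 0 := Complex.ofReal_ne_zero.2 ht.ne'
  field_simp

theorem fourierInv_heatSymbol {t : ℝ} (ht : 0 < t) (x : EuclideanSpace ℝ (Fin d)) :
    𝓕⁻ (heatSymbol t) x = complexHeatKernel t x := by
  have hb : 0 < ((4 * Real.pi ^ 2 * t : ℝ) : ℂ).re := by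
    rw [Complex.ofReal_re]
    positivity
  have h1 := fourier_gaussian_innerProductSpace hb (-x)
  have h2 : heatSymbol t = fun y : EuclideanSpace ℝ (Fin d) =>
      Complex.exp (-((4 * Real.pi ^ 2 * t : ℝ) : ℂ) * ‖y‖ ^ 2) := by
    funext y
    rw [heatSymbol]
    push_cast
    rfl
  have htc : (t : ℂ) ≠ 0 := Complex.ofReal_ne_zero.2 ht.ne'
  have hpi : (Real.pi : ℂ) ≠ 0 := Complex.ofReal_ne_zero.2 Real.pi_ne_zero
  rw [Real.fourierInv_eq_fourier_neg, h2, h1, finrank_euclideanSpace_fin, norm_neg,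
    complexHeatKernel]
  congr 1
  · have e1 : (Real.pi : ℂ) / ((4 * Real.pi ^ 2 * t : ℝ) : ℂ) = ((4 * Real.pi * t : ℝ) : ℂ)⁻¹ := by
      push_cast
      field_simp
    rw [e1, neg_div, Complex.cpow_neg, Complex.inv_cpow]
    · push_cast
      rfl
    · rw [Complex.arg_ofReal_of_nonneg (by positivity)]
      exact Real.pi_ne_zero.symm
  · congr 1
    push_cast
    field_simp

/-- The second spatial derivatives of the heat kernel at complex time. -/
noncomputable def heatHess {d : ℕ} (j k : Fin d) (Z : ℂ) (y : EuclideanSpace ℝ (Fin d)) : ℂ :=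
  ((y j : ℂ) * y k / (4 * Z ^ 2) - (if j = k then 1 else 0) / (2 * Z)) * complexHeatKernel Z y

theorem hasDerivAt_component_line (x : EuclideanSpace ℝ (Fin d)) (i k : Fin d) :
    HasDerivAt (fun s : ℝ => ((x + s • EuclideanSpace.single i (1 : ℝ)) k : ℂ))
      (if i = k then 1 else 0) 0 := by
  have h : HasDerivAt (fun s : ℝ => x k + s * (if i = k then 1 else 0))
      (if i = k then 1 else 0) 0 := by
    simpa using ((hasDerivAt_id (0 : ℝ)).mul_const (if i = k then (1 : ℝ) else 0)).const_add (x k)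
  convert h.ofReal_comp using 1
  · funext s
    simp [eq_comm]
  · split_ifs <;> simp

theorem hasDerivAt_complexHeatKernel_line {Z : ℂ} (hZ : Z ≠ 0) (x : EuclideanSpace ℝ (Fin d))
    (i : Fin d) :
    HasDerivAt (fun s : ℝ => complexHeatKernel Z (x + s • EuclideanSpace.single i (1 : ℝ)))
      (heatGrad i Z x) 0 := by
  have h1 : ∀ s : ℝ, ‖x + s • EuclideanSpace.single i (1 : ℝ)‖ ^ 2 =
      ‖x‖ ^ 2 + s * (2 * x i) + s ^ 2 := by
    intro s
    rw [norm_add_sq_real, inner_smul_right, EuclideanSpace.inner_single_right, norm_smul]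
    simp
    ring
  have h2 : HasDerivAt (fun s : ℝ => ‖x‖ ^ 2 + s * (2 * x i) + s ^ 2) (2 * x i) 0 := by
    have := (((hasDerivAt_id (0 : ℝ)).mul_const (2 * x i)).const_add (‖x‖ ^ 2)).add
      ((hasDerivAt_id (0 : ℝ)).pow 2)
    exact this.congr_deriv (by simp)
  have h3 := (((h2.ofReal_comp.neg).div_const (4 * Z)).cexp).const_mul
    ((4 * Real.pi * Z) ^ (-(d : ℂ) / 2))
  have e : (fun s : ℝ => complexHeatKernel Z (x + s • EuclideanSpace.single i (1 : ℝ))) =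
      fun s : ℝ => (4 * Real.pi * Z) ^ (-(d : ℂ) / 2) *
        Complex.exp (-((‖x‖ ^ 2 + s * (2 * x i) + s ^ 2 : ℝ) : ℂ) / (4 * Z)) := by
    funext s
    rw [← h1, complexHeatKernel]
    push_cast
    rfl
  rw [e]
  refine h3.congr_deriv ?_
  simp [heatGrad, complexHeatKernel]
  field_simp
  norm_num

theorem hasDerivAt_heatGrad_line {Z : ℂ} (hZ : Z ≠ 0) (x : EuclideanSpace ℝ (Fin d))
    (j k : Fin d) :
    HasDerivAt (fun s : ℝ => heatGrad k Z (x + s • EuclideanSpace.single j (1 : ℝ)))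
      (heatHess j k Z x) 0 := by
  have := ((hasDerivAt_component_line x j k).neg.div_const (2 * Z)).mul
    (hasDerivAt_complexHeatKernel_line hZ x j)
  refine this.congr_deriv ?_
  simp [heatGrad, heatHess]
  field_simp
  ring

theorem hasDerivAt_heatHess_line {Z : ℂ} (hZ : Z ≠ 0) (x : EuclideanSpace ℝ (Fin d))
    (i j k : Fin d) :
    HasDerivAt (fun s : ℝ => heatHess j k Z (x + s • EuclideanSpace.single i (1 : ℝ)))
      (heatThird i j k Z x) 0 := by
  have := ((((hasDerivAt_component_line x i j).mul
    (hasDerivAt_component_line x i k)).div_const (4 * Z ^ 2)).sub_const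
      ((if j = k then 1 else 0) / (2 * Z))).mul (hasDerivAt_complexHeatKernel_line hZ x i)
  refine this.congr_deriv ?_
  simp only [heatGrad, heatThird, Pi.mul_apply, zero_smul, add_zero]
  field_simp
  ring

theorem inner_single_eq (ξ : EuclideanSpace ℝ (Fin d)) (k : Fin d) :
    ⟪ξ, EuclideanSpace.single k (1 : ℝ)⟫ = ξ k := by
  simp [EuclideanSpace.inner_single_right]

theorem measurable_componentC (k : Fin d) :
    Measurable (fun ξ : EuclideanSpace ℝ (Fin d) => (ξ k : ℂ)) :=
  Complex.measurable_ofReal.comp (measurable_component k)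

theorem norm_two_pi_I : ‖(2 * Real.pi * Complex.I : ℂ)‖ = 2 * Real.pi := by
  simp [abs_of_pos Real.pi_pos]

theorem norm_two_pi_I_mul_le {P : EuclideanSpace ℝ (Fin d) → ℂ} {c : ℝ} {n : ℕ}
    (hb : ∀ ξ, ‖P ξ‖ ≤ c * ‖ξ‖ ^ n) (k : Fin d) (ξ : EuclideanSpace ℝ (Fin d)) :
    ‖2 * Real.pi * Complex.I * (ξ k : ℂ) * P ξ‖ ≤ (2 * Real.pi * c) * ‖ξ‖ ^ (n + 1) := by
  rw [norm_mul, norm_mul, norm_two_pi_I]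
  have h1 := norm_component_le ξ k
  have := Real.pi_pos
  calc _ ≤ 2 * Real.pi * ‖ξ‖ * (c * ‖ξ‖ ^ n) :=
        mul_le_mul (by gcongr) (hb ξ) (norm_nonneg _) (by positivity)
    _ = _ := by ring

theorem measurable_two_pi_I_mul {P : EuclideanSpace ℝ (Fin d) → ℂ} (hP : Measurable P)
    (k : Fin d) : Measurable (fun ξ => 2 * Real.pi * Complex.I * (ξ k : ℂ) * P ξ) :=
  ((measurable_componentC k).const_mul _).mul hP

/-- Transport of a spatial derivative through the inverse Fourier transform. -/
theorem fourierInv_component_mul_eq {t : ℝ} (ht : 0 < t) {P : EuclideanSpace ℝ (Fin d) → ℂ}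
    (hP : Measurable P) {c : ℝ} {n : ℕ} (hb : ∀ ξ, ‖P ξ‖ ≤ c * ‖ξ‖ ^ n)
    {F : EuclideanSpace ℝ (Fin d) → ℂ} (hF : ∀ x, 𝓕⁻ (fun ξ => P ξ * heatSymbol t ξ) x = F x)
    {x : EuclideanSpace ℝ (Fin d)} {k : Fin d} {a : ℂ}
    (ha : HasDerivAt (fun s : ℝ => F (x + s • EuclideanSpace.single k (1 : ℝ))) a 0) :
    𝓕⁻ (fun ξ => (2 * Real.pi * Complex.I * (ξ k : ℂ) * P ξ) * heatSymbol t ξ) x = a := by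
  have := fourierInv_inner_mul_eq (integrable_mul_heatSymbol ht hP hb)
    (integrable_norm_mul_heatSymbol ht hP hb) hF ha
  simp_rw [inner_single_eq, ← mul_assoc] at this
  simpa only [mul_assoc] using this

/-- The trailing factor 1 is the initial multiplier; keeping it lets the same differentiation step
be iterated literally. -/
theorem fourierInv_heatGrad {t : ℝ} (ht : 0 < t) (k : Fin d) (x : EuclideanSpace ℝ (Fin d)) :
    𝓕⁻ (fun ξ : EuclideanSpace ℝ (Fin d) =>
      (2 * Real.pi * Complex.I * (ξ k : ℂ) * 1) * heatSymbol t ξ) x = heatGrad k t x :=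
  fourierInv_component_mul_eq ht (P := fun _ => 1) measurable_const (c := 1) (n := 0) (by simp)
    (F := complexHeatKernel t) (fun x => by simpa using fourierInv_heatSymbol ht x)
    (hasDerivAt_complexHeatKernel_line (Complex.ofReal_ne_zero.2 ht.ne') x k)

theorem norm_one_le_pow_zero (ξ : EuclideanSpace ℝ (Fin d)) :
    ‖(fun _ : EuclideanSpace ℝ (Fin d) => (1 : ℂ)) ξ‖ ≤ 1 * ‖ξ‖ ^ 0 := by simp

theorem fourierInv_heatHess {t : ℝ} (ht : 0 < t) (j k : Fin d) (x : EuclideanSpace ℝ (Fin d)) :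
    𝓕⁻ (fun ξ : EuclideanSpace ℝ (Fin d) => (2 * Real.pi * Complex.I * (ξ j : ℂ) *
      (2 * Real.pi * Complex.I * (ξ k : ℂ) * 1)) * heatSymbol t ξ) x = heatHess j k t x :=
  fourierInv_component_mul_eq ht (measurable_two_pi_I_mul measurable_const k)
    (norm_two_pi_I_mul_le norm_one_le_pow_zero k) (fourierInv_heatGrad ht k)
    (hasDerivAt_heatGrad_line (Complex.ofReal_ne_zero.2 ht.ne') x j k)

/-- The Fourier multiplier of `∂_i ∂_j ∂_k`. -/
noncomputable def thirdSymbol (i j k : Fin d) (ξ : EuclideanSpace ℝ (Fin d)) : ℂ :=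
  2 * Real.pi * Complex.I * (ξ i : ℂ) * (2 * Real.pi * Complex.I * (ξ j : ℂ) *
      (2 * Real.pi * Complex.I * (ξ k : ℂ) * 1))

theorem measurable_thirdSymbol (i j k : Fin d) : Measurable (thirdSymbol i j k) :=
  measurable_two_pi_I_mul (measurable_two_pi_I_mul (measurable_two_pi_I_mul
    measurable_const k) j) i

theorem norm_thirdSymbol_le (i j k : Fin d) (ξ : EuclideanSpace ℝ (Fin d)) :
    ‖thirdSymbol i j k ξ‖ ≤ (2 * Real.pi * (2 * Real.pi * (2 * Real.pi * 1))) * ‖ξ‖ ^ 3 :=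
  norm_two_pi_I_mul_le (norm_two_pi_I_mul_le
    (norm_two_pi_I_mul_le norm_one_le_pow_zero k) j) i ξ

theorem fourierInv_heatThird {t : ℝ} (ht : 0 < t) (i j k : Fin d)
    (x : EuclideanSpace ℝ (Fin d)) :
    𝓕⁻ (fun ξ : EuclideanSpace ℝ (Fin d) => thirdSymbol i j k ξ * heatSymbol t ξ) x =
      heatThird i j k t x :=
  fourierInv_component_mul_eq ht (measurable_two_pi_I_mul (measurable_two_pi_I_mul
      measurable_const k) j)
    (norm_two_pi_I_mul_le (norm_two_pi_I_mul_le norm_one_le_pow_zero k) j)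
    (fourierInv_heatHess ht j k)
    (hasDerivAt_heatHess_line (Complex.ofReal_ne_zero.2 ht.ne') x i j k)

end Fourier

/-! ### The Oseen kernel through derivatives of the heat kernel. -/

section Stokes

open scoped RealInnerProductSpace

variable {d : ℕ}

theorem heatGrad_ofReal {t : ℝ} (ht : 0 < t) (k : Fin d) (y : EuclideanSpace ℝ (Fin d)) :
    ((heatGrad k t y).re : ℂ) = heatGrad k t y := by
  have h : heatGrad k t y = ((-(y k) / (2 * t) * heatKernel t y : ℝ) : ℂ) := by
    rw [heatGrad, complexHeatKernel_ofReal ht]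
    push_cast
    rfl
  rw [h, Complex.ofReal_re]

theorem heatThird_ofReal {t : ℝ} (ht : 0 < t) (i j k : Fin d) (y : EuclideanSpace ℝ (Fin d)) :
    ((heatThird i j k t y).re : ℂ) = heatThird i j k t y := by
  have h : heatThird i j k t y = (((-(y i * y j * y k) / (8 * t ^ 3) +
      ((if i = j then 1 else 0) * y k + (if i = k then 1 else 0) * y j +
        (if j = k then 1 else 0) * y i) / (4 * t ^ 2)) * heatKernel t y : ℝ) : ℂ) := by
    rw [heatThird, complexHeatKernel_ofReal ht]
    push_cast
    simp only [apply_ite Complex.ofReal, Complex.ofReal_one, Complex.ofReal_zero]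
  rw [h, Complex.ofReal_re]

theorem integrableOn_and_integral_heatSymbol_Ioi (t : ℝ) {ξ : EuclideanSpace ℝ (Fin d)} (hξ : ξ ≠ 0) :
    IntegrableOn (fun r => heatSymbol r ξ) (Ioi t) ∧
      ∫ r in Ioi t, heatSymbol r ξ =
        ((Real.exp (-(4 * Real.pi ^ 2 * t) * ‖ξ‖ ^ 2) / (4 * Real.pi ^ 2 * ‖ξ‖ ^ 2) : ℝ) : ℂ) := by
  have hn : 0 < ‖ξ‖ := norm_pos_iff.2 hξ
  have ha : -(4 * Real.pi ^ 2 * ‖ξ‖ ^ 2) < 0 := neg_neg_of_pos (by positivity)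
  have e : ∀ r : ℝ, heatSymbol r ξ =
      ((Real.exp (-(4 * Real.pi ^ 2 * ‖ξ‖ ^ 2) * r) : ℝ) : ℂ) := fun r => by
    rw [heatSymbol]
    congr 2
    ring
  constructor
  · simp_rw [e]
    exact (integrableOn_exp_mul_Ioi ha t).ofReal
  · simp_rw [e]
    rw [integral_complex_ofReal, integral_exp_mul_Ioi ha, neg_div_neg_eq]
    congr 3
    ring

theorem thirdSymbol_zero (i j k : Fin d) : thirdSymbol i j k 0 = 0 := by
  simp [thirdSymbol]

/-- The time integral costs a factor `|ξ|⁻²`, which the cubic symbol absorbs, leaving `|ξ|` times a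
Gaussian. This justifies exchanging the time integral with the Fourier integral. -/
theorem integrable_prod_thirdSymbol {t : ℝ} (ht : 0 < t) (i j k : Fin d) :
    Integrable (fun q : EuclideanSpace ℝ (Fin d) × ℝ =>
      thirdSymbol i j k q.1 * heatSymbol q.2 q.1)
      ((volume : Measure (EuclideanSpace ℝ (Fin d))).prod (volume.restrict (Ioi t))) := by
  have hm : Measurable (fun q : EuclideanSpace ℝ (Fin d) × ℝ =>
      thirdSymbol i j k q.1 * heatSymbol q.2 q.1) :=
    ((measurable_thirdSymbol i j k).comp measurable_fst).mul
      (measurable_heatSymbol.comp (measurable_snd.prodMk measurable_fst))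
  have hpi := Real.pi_pos
  refine (integrable_prod_iff hm.aestronglyMeasurable).2 ⟨Filter.Eventually.of_forall fun ξ => ?_,
    ?_⟩
  · rcases eq_or_ne ξ 0 with rfl | hξ
    · simp [thirdSymbol_zero]
    · exact Integrable.const_mul (integrableOn_and_integral_heatSymbol_Ioi t hξ).1 (thirdSymbol i j k ξ)
  · refine ((integrable_norm_pow_mul_exp (V := EuclideanSpace ℝ (Fin d)) 1
      (show 0 < 4 * Real.pi ^ 2 * t by positivity)).const_mul (2 * Real.pi)).mono' ?_
      (Filter.Eventually.of_forall fun ξ => ?_)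
    · exact hm.norm.aestronglyMeasurable.integral_prod_right'
    · simp only [norm_mul]
      rw [integral_const_mul]
      rcases eq_or_ne ξ 0 with rfl | hξ
      · simp [thirdSymbol_zero]
      · have h1 : ∫ r in Ioi t, ‖heatSymbol r ξ‖ =
            Real.exp (-(4 * Real.pi ^ 2 * t) * ‖ξ‖ ^ 2) / (4 * Real.pi ^ 2 * ‖ξ‖ ^ 2) := by
          have h2 := (integrableOn_and_integral_heatSymbol_Ioi t hξ).2
          have h3 : ∀ r, heatSymbol r ξ = ((‖heatSymbol r ξ‖ : ℝ) : ℂ) := fun r => by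
            rw [norm_heatSymbol, heatSymbol]
          rw [integral_congr_ae (Filter.Eventually.of_forall h3), integral_complex_ofReal] at h2
          exact_mod_cast h2
        have hn : 0 < ‖ξ‖ := norm_pos_iff.2 hξ
        rw [h1, Real.norm_of_nonneg (by positivity)]
        calc _ ≤ (2 * Real.pi * (2 * Real.pi * (2 * Real.pi * 1))) * ‖ξ‖ ^ 3 *
              (Real.exp (-(4 * Real.pi ^ 2 * t) * ‖ξ‖ ^ 2) / (4 * Real.pi ^ 2 * ‖ξ‖ ^ 2)) := by
              gcongr
              exact norm_thirdSymbol_le i j k ξ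
          _ = _ := by
              field_simp
              ring

/-- The pressure part of the multiplier as a time integral of third derivatives of the heat
kernel. -/
theorem fourierInv_integral_thirdSymbol {t : ℝ} (ht : 0 < t) (i j k : Fin d)
    (x : EuclideanSpace ℝ (Fin d)) :
    𝓕⁻ (fun ξ : EuclideanSpace ℝ (Fin d) =>
      ∫ r in Ioi t, thirdSymbol i j k ξ * heatSymbol r ξ) x =
      ∫ r in Ioi t, heatThird i j k r x := by
  rw [Real.fourierInv_eq']
  simp only [smul_eq_mul, ← integral_const_mul]
  rw [integral_integral_swap]
  · refine setIntegral_congr_fun measurableSet_Ioi fun r hr => ?_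
    rw [← fourierInv_heatThird (ht.trans hr), Real.fourierInv_eq']
    simp only [smul_eq_mul, ← mul_assoc]
  · refine ((integrable_prod_thirdSymbol ht i j k).bdd_mul (c := 1)
      (f := fun q : EuclideanSpace ℝ (Fin d) × ℝ =>
        Complex.exp (((2 * Real.pi * ⟪q.1, x⟫ : ℝ) : ℂ) * Complex.I)) ?_
      (Filter.Eventually.of_forall fun q => ?_)).congr
      (Filter.Eventually.of_forall fun q => ?_)
    · exact Continuous.aestronglyMeasurable (by fun_prop)
    · rw [Complex.norm_exp_ofReal_mul_I]
    · rfl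

theorem norm_helmholtzSymbol_le (i j : Fin d) (ξ : EuclideanSpace ℝ (Fin d)) :
    ‖(helmholtzSymbol i j ξ : ℂ)‖ ≤ 2 * ‖ξ‖ ^ 0 := by
  rw [pow_zero, mul_one, Complex.norm_real, helmholtzSymbol]
  have h1 : ‖(if i = j then (1 : ℝ) else 0)‖ ≤ 1 := by split_ifs <;> simp
  have h2 : ‖ξ i * ξ j / ‖ξ‖ ^ 2‖ ≤ 1 := by
    rw [norm_div, norm_mul, norm_pow, norm_norm]
    refine div_le_one_of_le₀ ?_ (by positivity)
    rw [sq]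
    exact mul_le_mul (PiLp.norm_apply_le ξ i) (PiLp.norm_apply_le ξ j) (norm_nonneg _)
      (norm_nonneg _)
  exact (norm_sub_le _ _).trans (by linarith)

theorem measurable_helmholtzSymbol (i j : Fin d) :
    Measurable (fun ξ : EuclideanSpace ℝ (Fin d) => (helmholtzSymbol i j ξ : ℂ)) :=
  Complex.measurable_ofReal.comp (measurable_const.sub
    (((measurable_component i).mul (measurable_component j)).div (measurable_norm.pow_const 2)))

/-- The singular factor `|ξ|⁻²` of the Helmholtz symbol is written as a time integral of heat
symbols; the sign is right because `i² = -1`. At `ξ = 0`, where that time integral diverges, the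
vanishing of `thirdSymbol` makes both sides zero. -/
theorem deriv_symbol_eq (t : ℝ) (i j k : Fin d) (ξ : EuclideanSpace ℝ (Fin d)) :
    2 * Real.pi * Complex.I * (ξ k : ℂ) * (helmholtzSymbol i j ξ * heatSymbol t ξ) =
      (if i = j then 1 else 0) * ((2 * Real.pi * Complex.I * (ξ k : ℂ) * 1) * heatSymbol t ξ) +
        ∫ r in Ioi t, thirdSymbol i j k ξ * heatSymbol r ξ := by
  rw [integral_const_mul]
  rcases eq_or_ne ξ 0 with rfl | hξ
  · simp [thirdSymbol_zero]
  · rw [(integrableOn_and_integral_heatSymbol_Ioi t hξ).2, helmholtzSymbol, thirdSymbol, heatSymbol]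
    have hn : (‖ξ‖ : ℂ) ≠ 0 := Complex.ofReal_ne_zero.2 (norm_ne_zero_iff.2 hξ)
    have hpi : (Real.pi : ℂ) ≠ 0 := Complex.ofReal_ne_zero.2 Real.pi_ne_zero
    push_cast
    simp only [apply_ite Complex.ofReal, Complex.ofReal_one, Complex.ofReal_zero]
    generalize Complex.exp (-(4 * (Real.pi : ℂ) ^ 2 * t) * (‖ξ‖ : ℂ) ^ 2) = g
    generalize ((if i = j then 1 else 0) : ℂ) = δ
    field_simp
    linear_combination (-4 * (ξ k : ℂ) * ξ i * ξ j * g) * Complex.I_sq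

/-- The derivative of the Stokes-Oseen kernel in terms of derivatives of the heat kernel. -/
theorem stokesKernelDeriv_eq {t : ℝ} (ht : 0 < t) (i j k : Fin d)
    (x : EuclideanSpace ℝ (Fin d)) :
    (stokesKernelDeriv i j k t x : ℂ) =
      (if i = j then 1 else 0) * heatGrad k t x + ∫ r in Ioi t, heatThird i j k r x := by
  set f : EuclideanSpace ℝ (Fin d) → ℂ :=
    fun ξ => (helmholtzSymbol i j ξ : ℂ) * heatSymbol t ξ with hf
  have hfi : Integrable f := integrable_mul_heatSymbol ht (measurable_helmholtzSymbol i j)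
    (norm_helmholtzSymbol_le i j)
  have hfi' := integrable_norm_mul_heatSymbol ht (measurable_helmholtzSymbol i j)
    (norm_helmholtzSymbol_le i j)
  obtain ⟨L, hL, hLe⟩ := exists_hasFDerivAt_fourierInv hfi hfi' x (EuclideanSpace.single k 1)
  have hS : stokesKernel i j t = fun y => (𝓕⁻ f y).re := by
    funext y
    unfold stokesKernel
    simp_rw [fourier_heatKernel ht]
    rfl
  have h1 : HasFDerivAt (stokesKernel i j t) (Complex.reCLM.comp L) x := by
    rw [hS]
    exact Complex.reCLM.hasFDerivAt.comp x hL
  have h2 : stokesKernelDeriv i j k t x = (L (EuclideanSpace.single k 1)).re := by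
    rw [stokesKernelDeriv, h1.fderiv]
    rfl
  have hgi : Integrable (fun ξ : EuclideanSpace ℝ (Fin d) =>
      (2 * Real.pi * Complex.I * (ξ k : ℂ) * 1) * heatSymbol t ξ) :=
    integrable_mul_heatSymbol ht (measurable_two_pi_I_mul measurable_const k)
      (norm_two_pi_I_mul_le norm_one_le_pow_zero k)
  have h3 : L (EuclideanSpace.single k 1) =
      (if i = j then 1 else 0) * heatGrad k t x + ∫ r in Ioi t, heatThird i j k r x := by
    rw [hLe, ← fourierInv_heatGrad ht, ← fourierInv_integral_thirdSymbol ht]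
    simp_rw [inner_single_eq, hf, deriv_symbol_eq]
    rw [Real.fourierInv_eq', Real.fourierInv_eq', Real.fourierInv_eq', ← integral_const_mul,
      ← integral_add]
    · refine integral_congr_ae (Filter.Eventually.of_forall fun ξ => ?_)
      simp only [smul_eq_mul]
      ring
    · refine Integrable.const_mul (Integrable.bdd_mul (c := 1) hgi
        (Continuous.aestronglyMeasurable (by fun_prop)) (Filter.Eventually.of_forall fun q => ?_)) _
      rw [Complex.norm_exp_ofReal_mul_I]
    · refine Integrable.bdd_mul (c := 1) (integrable_prod_thirdSymbol ht i j k).integral_prod_left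
        (Continuous.aestronglyMeasurable (by fun_prop)) (Filter.Eventually.of_forall fun q => ?_)
      rw [Complex.norm_exp_ofReal_mul_I]
  have h4 : ∫ r in Ioi t, heatThird i j k r x =
      ((∫ r in Ioi t, (heatThird i j k r x).re : ℝ) : ℂ) := by
    rw [← integral_complex_ofReal]
    exact setIntegral_congr_fun measurableSet_Ioi fun r hr =>
      (heatThird_ofReal (ht.trans hr) i j k x).symm
  rw [h2, h3, h4, ← heatGrad_ofReal ht]
  split_ifs
  · simp
  · simp

/-- At real parameters, `dilatedStokes` is the dilated Stokes-Oseen kernel. -/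
theorem dilatedStokes_ofReal {l : ℝ} (hl : 0 < l) {q : SpaceTime d} (hq : q.1 ∈ Ioo (0 : ℝ) 1)
    (i j k : Fin d) :
    dilatedStokes i j k (l : ℂ) q = ((l * stokesKernelDeriv i j k (l * q.1) q.2 : ℝ) : ℂ) := by
  have h0 : 0 < l * q.1 := mul_pos hl hq.1
  have hm : q ∈ Ioo (0 : ℝ) 1 ×ˢ (univ : Set (EuclideanSpace ℝ (Fin d))) := ⟨hq, mem_univ _⟩
  rw [dilatedStokes, indicator_of_mem hm, Complex.ofReal_mul, stokesKernelDeriv_eq h0]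
  have h1 := integral_comp_mul_left_Ioi (fun r : ℝ => heatThird i j k (r : ℂ) q.2) q.1 hl
  simp only [Complex.ofReal_mul] at h1 ⊢
  rw [h1, Complex.real_smul, Complex.ofReal_inv,
    mul_inv_cancel_left₀ (Complex.ofReal_ne_zero.2 hl.ne')]

end Stokes

/-! ### Dilated mild solutions as Picard fixed points. -/

section MildSolution

variable {d : ℕ} {C : ℝ} {u : ℝ → EuclideanSpace ℝ (Fin d) → EuclideanSpace ℝ (Fin d)}

/-- The complexification of `u` on `(0,1] × ℝ^d`, extended by zero. -/
noncomputable def complexField (u : ℝ → EuclideanSpace ℝ (Fin d) → EuclideanSpace ℝ (Fin d))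
    (p : SpaceTime d) (i : Fin d) : ℂ :=
  (Ioc (0 : ℝ) 1 ×ˢ univ).indicator (fun p : SpaceTime d => (u p.1 p.2 i : ℂ)) p

theorem complexField_of_mem {p : SpaceTime d} (hp : p.1 ∈ Ioc (0 : ℝ) 1) (i : Fin d) :
    complexField u p i = (u p.1 p.2 i : ℂ) :=
  indicator_of_mem (show p ∈ Ioc (0 : ℝ) 1 ×ˢ univ from ⟨hp, mem_univ _⟩) _

theorem complexField_of_notMem {p : SpaceTime d} (hp : p.1 ∉ Ioc (0 : ℝ) 1) :
    complexField u p = 0 :=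
  funext fun _ => indicator_of_notMem (fun h => hp h.1) _

theorem IsBoundedMildSolution.nonneg (h : IsBoundedMildSolution C u) : 0 ≤ C :=
  (norm_nonneg _).trans (h.bound 0 ⟨le_rfl, zero_le_one⟩ 0)

theorem IsBoundedMildSolution.norm_complexField_le (h : IsBoundedMildSolution C u)
    (p : SpaceTime d) : ‖complexField u p‖ ≤ C := by
  by_cases hp : p.1 ∈ Ioc (0 : ℝ) 1
  · refine (pi_norm_le_iff_of_nonneg h.nonneg).2 fun i => ?_
    rw [complexField_of_mem hp]
    exact (norm_component_le _ i).trans (h.bound p.1 ⟨hp.1.le, hp.2⟩ p.2)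
  · rw [complexField_of_notMem hp, norm_zero]
    exact h.nonneg

theorem IsBoundedMildSolution.aestronglyMeasurable_complexField
    (h : IsBoundedMildSolution C u) : AEStronglyMeasurable (complexField u) := by
  refine (aemeasurable_pi_lambda _ fun i => ?_).aestronglyMeasurable
  change AEMeasurable (indicator _ _) volume
  refine (aemeasurable_indicator_iff (measurableSet_Ioc.prod MeasurableSet.univ)).2 ?_
  have h1 := (h.aestronglyMeasurable.aemeasurable).mono_measure (Measure.restrict_mono
    (prod_mono (Ioc_subset_Icc_self (a := (0 : ℝ)) (b := 1)) subset_rfl) le_rfl)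
  exact (measurable_componentC i).comp_aemeasurable h1

/-- The initial datum, made measurable, bounded and complex. -/
theorem IsBoundedMildSolution.exists_initial (h : IsBoundedMildSolution C u) :
    ∃ u₀ : EuclideanSpace ℝ (Fin d) → Fin d → ℂ, Measurable u₀ ∧ (∀ y, ‖u₀ y‖ ≤ C) ∧
      ∀ᵐ y, ∀ i, u₀ y i = (u 0 y i : ℂ) := by
  classical
  obtain ⟨g, hg, hug⟩ := h.aestronglyMeasurable_zero
  have hgm := hg.measurable
  -- Truncation at `C` makes the bound hold everywhere and changes nothing where `g` agrees with `u
  -- 0`.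
  refine ⟨fun y i => if ‖g y‖ ≤ C then (g y i : ℂ) else 0, measurable_pi_lambda _ fun i =>
    Measurable.ite (measurableSet_le hgm.norm measurable_const)
      ((measurable_componentC i).comp hgm) measurable_const, fun y => ?_, ?_⟩
  · refine (pi_norm_le_iff_of_nonneg h.nonneg).2 fun i => ?_
    dsimp only
    split_ifs with hy
    · exact (norm_component_le _ i).trans hy
    · simpa using h.nonneg
  · filter_upwards [hug] with y hy i
    have := h.bound 0 ⟨le_rfl, zero_le_one⟩ y
    rw [hy] at this
    rw [if_pos this, hy]

theorem duhamel_congr_ae {K : Fin d → Fin d → Fin d → ℂ → SpaceTime d → ℂ} {z : ℂ}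
    {v w : SpaceTime d → Fin d → ℂ} (hvw : v =ᵐ[volume] w) (i : Fin d) (p : SpaceTime d) :
    duhamel K z v i p = duhamel K z w i p := by
  refine Finset.sum_congr rfl fun j _ => Finset.sum_congr rfl fun k _ => integral_congr_ae ?_
  filter_upwards [hvw] with q hq
  rw [hq]

/-- The quadratic term as an iterated integral. -/
theorem duhamel_eq_integral_integral {K : Fin d → Fin d → Fin d → ℂ → SpaceTime d → ℂ} {ρ : ℝ}
    {H : SpaceTime d → ℝ} (hK : IsDominatedKernel K ρ H) {z : ℂ}
    (hz : z ∈ Metric.ball (1 : ℂ) ρ) {v : SpaceTime d → Fin d → ℂ} {R : ℝ}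
    (hv : AEStronglyMeasurable v) (hR : ∀ q, ‖v q‖ ≤ R) (i : Fin d) (p : SpaceTime d) :
    duhamel K z v i p = ∫ s, ∑ j, ∑ k, ∫ y, K i j k z (p - (s, y)) * (v (s, y) j * v (s, y) k) := by
  have hint := fun j k => integrable_duhamel_integrand hK hz hv hR i j k p
  rw [integral_finsetSum]
  · refine Finset.sum_congr rfl fun j _ => ?_
    rw [integral_finsetSum _ fun k _ => (hint j k).integral_prod_left]
    exact Finset.sum_congr rfl fun k _ => integral_prod _ (hint j k)
  · exact fun j _ => integrable_finsetSum _ fun k _ => (hint j k).integral_prod_left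

theorem freeTerm_eq_ofReal
    {u₀ : EuclideanSpace ℝ (Fin d) → Fin d → ℂ} (hu₀ : ∀ᵐ y, ∀ i, u₀ y i = (u 0 y i : ℂ))
    {l t : ℝ} (hlt : 0 < l * t) (x : EuclideanSpace ℝ (Fin d)) (i : Fin d) :
    freeTerm u₀ l i (t, x) = ((∫ y, heatKernel (l * t) (x - y) * u 0 y i : ℝ) : ℂ) := by
  rw [← integral_complex_ofReal]
  refine integral_congr_ae ?_
  filter_upwards [hu₀] with y hy
  rw [hy, ← Complex.ofReal_mul, complexHeatKernel_ofReal hlt, Complex.ofReal_mul]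

/-- Real dilations of a mild solution are fixed points of the Picard map. -/
theorem IsBoundedMildSolution.complexField_eq (h : IsBoundedMildSolution C u)
    {u₀ : EuclideanSpace ℝ (Fin d) → Fin d → ℂ} (hu₀ : ∀ᵐ y, ∀ i, u₀ y i = (u 0 y i : ℂ))
    {l : ℝ} (hl : (l : ℂ) ∈ Metric.ball (1 : ℂ) (1 / 2))
    (hm : AEStronglyMeasurable (fun q : SpaceTime d => complexField u (l * q.1, q.2)))
    {p : SpaceTime d} (hp : p.1 ∈ Ioc (0 : ℝ) 1) (hlp : l * p.1 ≤ 1) (i : Fin d) :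
    complexField u (l * p.1, p.2) i = freeTerm u₀ l i p -
      duhamel dilatedStokes l (fun q : SpaceTime d => complexField u (l * q.1, q.2)) i p := by
  obtain ⟨t, x⟩ := p
  simp only at hp hlp ⊢
  have hl0 : 0 < l := by
    have := re_pos_of_mem_ball hl
    rw [Complex.ofReal_re] at this
    linarith
  have hlt : 0 < l * t := mul_pos hl0 hp.1
  rw [complexField_of_mem ⟨hlt, hlp⟩]
  simp only
  rw [h.integral_eq (l * t) ⟨hlt, hlp⟩ x i, Complex.ofReal_sub, freeTerm_eq_ofReal hu₀ hlt,
    duhamel_eq_integral_integral isDominatedKernel_dilatedStokes hl hm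
      (fun q => h.norm_complexField_le _)]
  congr 1
  -- The substitution `s ↦ l s` moves the dilation from the field to the kernel; its Jacobian is the
  -- outer factor of `dilatedStokes`.
  have h1 := intervalIntegral.mul_integral_comp_mul_left (a := 0) (b := t) (c := l)
    (f := fun s => ∑ j : Fin d, ∑ k : Fin d,
        ∫ y, stokesKernelDeriv i j k (l * t - s) (x - y) * (u s y j * u s y k))
  rw [mul_zero] at h1
  rw [← h1, intervalIntegral.integral_of_le hp.1.le, integral_Ioc_eq_integral_Ioo,
    ← integral_const_mul, ← integral_complex_ofReal, ← integral_indicator measurableSet_Ioo]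
  refine integral_congr_ae (Filter.Eventually.of_forall fun s => ?_)
  simp only [Prod.mk_sub_mk]
  by_cases hs : s ∈ Ioo 0 t
  · rw [indicator_of_mem hs]
    have hls : l * s ∈ Ioc (0 : ℝ) 1 :=
      ⟨mul_pos hl0 hs.1, (mul_le_mul_of_nonneg_left hs.2.le hl0.le).trans hlp⟩
    have hts : t - s ∈ Ioo (0 : ℝ) 1 := ⟨sub_pos.2 hs.2, by linarith [hs.1, hp.2]⟩
    rw [Finset.mul_sum, Complex.ofReal_sum]
    refine Finset.sum_congr rfl fun j _ => ?_
    rw [Finset.mul_sum, Complex.ofReal_sum]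
    refine Finset.sum_congr rfl fun k _ => ?_
    rw [← integral_const_mul, ← integral_complex_ofReal]
    refine integral_congr_ae (Filter.Eventually.of_forall fun y => ?_)
    simp only
    rw [dilatedStokes_ofReal hl0 (q := (t - s, x - y)) hts, complexField_of_mem hls,
      complexField_of_mem hls, mul_sub]
    push_cast
    ring
  -- Off `(0,t)` the space-time integrand vanishes: the field is zero for `s ≤ 0`, the kernel for `s
  -- ≥ t`.
  · rw [indicator_of_notMem hs]
    symm
    refine Finset.sum_eq_zero fun j _ => Finset.sum_eq_zero fun k _ => ?_
    refine integral_eq_zero_of_ae (Filter.Eventually.of_forall fun y => ?_)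
    simp only [Pi.zero_apply]
    rcases le_or_gt s 0 with h0 | h0
    · rw [complexField_of_notMem (p := (l * s, y))
        (fun h2 => not_lt.2 (mul_nonpos_of_nonneg_of_nonpos hl0.le h0) h2.1)]
      simp
    · have hst : t ≤ s := not_lt.1 fun h2 => hs ⟨h0, h2⟩
      rw [dilatedStokes, indicator_of_notMem, zero_mul]
      exact fun h2 => not_lt.2 (sub_nonpos.2 hst) h2.1.1

/-- The Duhamel term sees only the almost everywhere class of the field, and the mild equation holds
at every point. So the field equals the Picard step of a measurable representative, hence is itself
measurable. This gives measurability of every time slice, a null set of times included. -/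
theorem IsBoundedMildSolution.measurable_complexField (h : IsBoundedMildSolution C u) :
    Measurable (complexField u) := by
  obtain ⟨u₀, hu₀m, -, hu₀⟩ := h.exists_initial
  obtain ⟨g, hg, hug⟩ := h.aestronglyMeasurable_complexField
  have h1 : (1 : ℂ) ∈ Metric.ball (1 : ℂ) (1 / 2) := Metric.mem_ball_self (by norm_num)
  have heq : complexField u = picardStep (freeTerm u₀) dilatedStokes 1 g := by
    funext p i
    by_cases hp : p.1 ∈ Ioc (0 : ℝ) 1
    · rw [picardStep_of_mem hp, ← duhamel_congr_ae hug]
      have := h.complexField_eq hu₀ (l := 1) (by simp)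
        (by simpa using h.aestronglyMeasurable_complexField) hp (by simpa using hp.2) i
      simpa using this
    · rw [picardStep_of_notMem hp, complexField_of_notMem hp]
  rw [heq]
  exact measurable_picardStep isDominatedKernel_dilatedStokes h1
    (fun i => measurable_freeTerm hu₀m 1 i) hg.measurable

theorem IsBoundedMildSolution.measurable_slice (h : IsBoundedMildSolution C u) {t : ℝ}
    (ht : t ∈ Ioc (0 : ℝ) 1) : Measurable (u t) := by
  have h1 : ∀ i, Measurable (fun x => u t x i) := fun i => by
    have := Complex.measurable_re.comp ((measurable_pi_apply i).comp
      (h.measurable_complexField.comp (measurable_prodMk_left (x := t))))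
    have e : (fun x => u t x i) = fun x => (complexField u (t, x) i).re := by
      funext x
      rw [complexField_of_mem (u := u) (p := (t, x)) ht, Complex.ofReal_re]
    rw [e]
    exact this
  exact (WithLp.measurable_toLp 2 _).comp (measurable_pi_lambda _ h1)

/-- A bounded mild solution extends holomorphically in the dilation parameter of time. -/
theorem exists_holomorphic_dilation (d : ℕ) (C : ℝ) :
    ∃ ε : ℝ, 0 < ε ∧ ∀ u : ℝ → EuclideanSpace ℝ (Fin d) → EuclideanSpace ℝ (Fin d),
      IsBoundedMildSolution C u → ∀ t ∈ Ioc (0 : ℝ) 1, ∀ x i, ∃ f : ℂ → ℂ,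
        DifferentiableOn ℂ f (Metric.ball 1 ε) ∧ (∀ z ∈ Metric.ball (1 : ℂ) ε, ‖f z‖ ≤ C + 1) ∧
        ∀ s ∈ Ioc (0 : ℝ) 1, ((s / t : ℝ) : ℂ) ∈ Metric.ball (1 : ℂ) ε →
          f ((s / t : ℝ) : ℂ) = (u s x i : ℂ) := by
  -- For negative `C` there are no solutions, so any radius serves.
  rcases lt_or_ge C 0 with hC | hC
  · exact ⟨1, one_pos, fun u hu => absurd hu.nonneg (not_le.2 hC)⟩
  obtain ⟨ε, hε, hε2, H⟩ := exists_holomorphic_family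
    (isDominatedKernel_dilatedStokes (d := d)) (by norm_num) hC
    (M := (18 : ℝ) ^ ((d : ℝ) / 2) * C) (by positivity)
  refine ⟨ε, hε, fun u hu t ht x i => ?_⟩
  obtain ⟨u₀, hu₀m, hu₀C, hu₀⟩ := hu.exists_initial
  have hUm := hu.measurable_complexField
  have hfix : ∀ l : ℝ, (l : ℂ) ∈ Metric.ball (1 : ℂ) (1 / 2) → ∀ p : SpaceTime d, p.1 ≤ 1 →
      l * p.1 ≤ 1 → complexField u (l * p.1, p.2) = picardStep (freeTerm u₀) dilatedStokes l
        (fun q : SpaceTime d => complexField u (l * q.1, q.2)) p := by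
    intro l hl p hp1 hlp
    have hl0 : 0 < l := by
      have := re_pos_of_mem_ball hl
      rw [Complex.ofReal_re] at this
      linarith
    funext i
    by_cases hp : p.1 ∈ Ioc (0 : ℝ) 1
    · rw [picardStep_of_mem hp]
      refine hu.complexField_eq hu₀ hl (Measurable.aestronglyMeasurable ?_) hp hlp i
      exact hUm.comp ((measurable_fst.const_mul l).prodMk measurable_snd)
    · have hp0 : p.1 ≤ 0 := not_lt.1 fun h0 => hp ⟨h0, hp1⟩
      rw [picardStep_of_notMem hp, complexField_of_notMem
        (fun h2 => not_lt.2 (mul_nonpos_of_nonneg_of_nonpos hl0.le hp0) h2.1)]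
  have hone : ∀ p, picardStep (freeTerm u₀) dilatedStokes 1 (complexField u) p =
      complexField u p := by
    intro p
    by_cases hp : p.1 ≤ 1
    · have := hfix 1 (by simp) p hp (by simpa using hp)
      simpa using this.symm
    · rw [picardStep_of_notMem (fun h2 => hp h2.2), complexField_of_notMem (fun h2 => hp h2.2)]
  obtain ⟨f, hfd, hfb, hfu⟩ := H (freeTerm u₀) (complexField u)
    (fun i p hp => differentiableOn_freeTerm hu₀m hu₀C i hp.1)
    (fun z _ i => measurable_freeTerm hu₀m z i)
    (fun z hz i p hp => norm_freeTerm_le hu₀C hz i hp.1) hUm hu.norm_complexField_le hone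
  refine ⟨f (t, x) i, hfd _ _, hfb _ _, fun s hs hst => ?_⟩
  have hst2 := Metric.ball_subset_ball hε2 hst
  have hl0 : 0 < s / t := div_pos hs.1 ht.1
  have hlt : s / t * t = s := div_mul_cancel₀ s ht.1.ne'
  -- The dilated field solves the equation only while `(s / t) * p.1 ≤ 1`, hence the cut-off time `1
  -- / (s / t)`. The point `(t, x)` qualifies because it is sent to time `s ≤ 1`.
  rw [hfu _ hst (1 / (s / t)) (fun q : SpaceTime d => complexField u (s / t * q.1, q.2))
    (hUm.comp ((measurable_fst.const_mul _).prodMk measurable_snd)).aestronglyMeasurable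
    (fun q => (hu.norm_complexField_le _).trans (by linarith))
    (fun p hp1 hpT => hfix _ hst2 p hp1 (by rwa [le_div_iff₀' hl0] at hpT)) (t, x) ht.2
    (by rw [le_div_iff₀' hl0, hlt]; exact hs.2) i]
  simp only [hlt]
  exact complexField_of_mem (p := (s, x)) hs i

end MildSolution

/-! ### From holomorphy in the dilation parameter to time derivatives. -/

section TimeAnalyticity

open Filter Topology

theorem iteratedDerivWithin_clm_comp {E F : Type*} [NormedAddCommGroup E] [NormedSpace ℝ E]
    [NormedAddCommGroup F] [NormedSpace ℝ F] (L : E →L[ℝ] F) {φ : ℝ → E} {I : Set ℝ} {t : ℝ}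
    {n : ℕ} (hφ : ContDiffWithinAt ℝ n φ I t) (hI : UniqueDiffOn ℝ I) (ht : t ∈ I) :
    iteratedDerivWithin n (fun s => L (φ s)) I t = L (iteratedDerivWithin n φ I t) := by
  have := L.iteratedFDerivWithin_comp_left hφ hI ht (i := n) le_rfl
  rw [iteratedDerivWithin, iteratedDerivWithin, show (fun s => L (φ s)) = L ∘ φ from rfl, this]
  rfl

section OneDimensional

variable {φ : ℝ → ℝ} {F : ℂ → ℂ} {ε t : ℝ}

theorem isOpen_dilation_ball (ε t : ℝ) :
    IsOpen {s : ℝ | ((s / t : ℝ) : ℂ) ∈ Metric.ball (1 : ℂ) ε} :=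
  Metric.isOpen_ball.preimage (by fun_prop)

theorem dilation_self_mem_ball (hε : 0 < ε) (ht : 0 < t) :
    ((t / t : ℝ) : ℂ) ∈ Metric.ball (1 : ℂ) ε := by
  rw [div_self ht.ne', Complex.ofReal_one]
  exact Metric.mem_ball_self hε

theorem dilation_ball_mem_nhds (hε : 0 < ε) (ht : 0 < t) :
    {s : ℝ | ((s / t : ℝ) : ℂ) ∈ Metric.ball (1 : ℂ) ε} ∈ 𝓝 t :=
  (isOpen_dilation_ball ε t).mem_nhds (dilation_self_mem_ball hε ht)

theorem analyticWithinAt_of_holomorphic_dilation (hε : 0 < ε) (ht : t ∈ Ioc (0 : ℝ) 1)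
    (hF : DifferentiableOn ℂ F (Metric.ball 1 ε))
    (hφ : ∀ s ∈ Ioc (0 : ℝ) 1, ((s / t : ℝ) : ℂ) ∈ Metric.ball (1 : ℂ) ε →
      F ((s / t : ℝ) : ℂ) = (φ s : ℂ)) :
    AnalyticWithinAt ℝ φ (Ioc 0 1) t := by
  have h1 : AnalyticAt ℝ F ((t / t : ℝ) : ℂ) := by
    exact AnalyticAt.restrictScalars (𝕜' := ℂ)
      (hF.analyticAt (Metric.isOpen_ball.mem_nhds (dilation_self_mem_ball hε ht.1)))
  have h2 : AnalyticAt ℝ (fun s : ℝ => ((s / t : ℝ) : ℂ)) t :=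
    (Complex.ofRealCLM.analyticAt _).comp (analyticAt_id.div_const)
  have h3 : AnalyticAt ℝ (fun s : ℝ => (F ((s / t : ℝ) : ℂ)).re) t :=
    (Complex.reCLM.analyticAt _).comp (AnalyticAt.comp (f := fun s : ℝ => ((s / t : ℝ) : ℂ)) h1 h2)
  have heq : ∀ s ∈ Ioc (0 : ℝ) 1, ((s / t : ℝ) : ℂ) ∈ Metric.ball (1 : ℂ) ε →
      φ s = (F ((s / t : ℝ) : ℂ)).re := fun s hs hst => by rw [hφ s hs hst, Complex.ofReal_re]
  refine h3.analyticWithinAt.congr_of_eventuallyEq ?_ ?_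
  · filter_upwards [self_mem_nhdsWithin, mem_nhdsWithin_of_mem_nhds
      (dilation_ball_mem_nhds hε ht.1)] with s hs hst using heq s hs hst
  · exact heq t ht (dilation_self_mem_ball hε ht.1)

/-- Each real derivative of `s ↦ F (s / t)` brings out a factor `1 / t`. The identity is proved at
all nearby `s`, not just at `s = t`, so that the induction can differentiate it. -/
theorem iteratedDerivWithin_of_holomorphic_dilation
    (hF : DifferentiableOn ℂ F (Metric.ball 1 ε))
    (hφ : ∀ s ∈ Ioc (0 : ℝ) 1, ((s / t : ℝ) : ℂ) ∈ Metric.ball (1 : ℂ) ε →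
      F ((s / t : ℝ) : ℂ) = (φ s : ℂ)) (n : ℕ) :
    ∀ s ∈ Ioc (0 : ℝ) 1, ((s / t : ℝ) : ℂ) ∈ Metric.ball (1 : ℂ) ε →
      iteratedDerivWithin n φ (Ioc 0 1) s =
        (iteratedDeriv n F ((s / t : ℝ) : ℂ)).re / t ^ n := by
  induction n with
  | zero =>
    intro s hs hst
    rw [iteratedDerivWithin_zero, iteratedDeriv_zero, hφ s hs hst, Complex.ofReal_re, pow_zero,
      div_one]
  | succ n ih =>
    intro s hs hst
    have hev : iteratedDerivWithin n φ (Ioc 0 1) =ᶠ[𝓝[Ioc 0 1] s]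
        fun r => (iteratedDeriv n F ((r / t : ℝ) : ℂ)).re / t ^ n := by
      filter_upwards [self_mem_nhdsWithin, mem_nhdsWithin_of_mem_nhds
        ((isOpen_dilation_ball ε t).mem_nhds hst)] with r hr hrt using ih r hr hrt
    rw [iteratedDerivWithin_succ, hev.derivWithin_eq (ih s hs hst), iteratedDeriv_succ]
    have hA : AnalyticAt ℂ (iteratedDeriv n F) ((s / t : ℝ) : ℂ) := by
      rw [iteratedDeriv_eq_iterate]
      exact (hF.analyticAt (Metric.isOpen_ball.mem_nhds hst)).iterated_deriv n
    have h1 : HasDerivAt (fun r : ℝ => (iteratedDeriv n F (r : ℂ)).re)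
        (deriv (iteratedDeriv n F) ((s / t : ℝ) : ℂ)).re (s / t) :=
      hA.differentiableAt.hasDerivAt.real_of_complex
    have h2 : HasDerivAt (fun r : ℝ => r / t) (1 / t) s := (hasDerivAt_id s).div_const t
    have h3 := (HasDerivAt.comp (h := fun r : ℝ => r / t) s h1 h2).div_const (t ^ n)
    refine (h3.hasDerivWithinAt.derivWithin
      ((uniqueDiffOn_Ioc 0 1).uniqueDiffWithinAt hs)).trans ?_
    rw [mul_one_div, div_div, pow_succ, mul_comm (t ^ n)]

/-- Cauchy's estimate on the circle of radius `ε / 2`, whose closed disc lies in the open disc where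
`F` is controlled. -/
theorem abs_iteratedDerivWithin_le_of_holomorphic_dilation {R : ℝ} (hε : 0 < ε)
    (ht : t ∈ Ioc (0 : ℝ) 1)
    (hF : DifferentiableOn ℂ F (Metric.ball 1 ε)) (hR : ∀ z ∈ Metric.ball (1 : ℂ) ε, ‖F z‖ ≤ R)
    (hφ : ∀ s ∈ Ioc (0 : ℝ) 1, ((s / t : ℝ) : ℂ) ∈ Metric.ball (1 : ℂ) ε →
      F ((s / t : ℝ) : ℂ) = (φ s : ℂ)) (n : ℕ) :
    |iteratedDerivWithin n φ (Ioc 0 1) t| ≤ (n.factorial * R * (2 / ε) ^ n) / t ^ n := by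
  rw [iteratedDerivWithin_of_holomorphic_dilation hF hφ n t ht
    (dilation_self_mem_ball hε ht.1), div_self ht.1.ne',
    Complex.ofReal_one, abs_div, abs_of_pos (pow_pos ht.1 n)]
  have hsub : Metric.closedBall (1 : ℂ) (ε / 2) ⊆ Metric.ball 1 ε :=
    Metric.closedBall_subset_ball (by linarith)
  have h1 : ‖iteratedDeriv n F 1‖ ≤ n.factorial * R / (ε / 2) ^ n := by
    refine Complex.norm_iteratedDeriv_le_of_forall_mem_sphere_norm_le n (by positivity) ?_
      fun z hz => hR z (hsub (Metric.sphere_subset_closedBall hz))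
    refine DifferentiableOn.diffContOnCl (hF.mono ?_)
    rw [closure_ball _ (by positivity)]
    exact hsub
  have hpos := ht.1
  gcongr
  refine ((Complex.abs_re_le_norm _).trans h1).trans_eq ?_
  rw [div_eq_mul_inv, ← inv_pow, inv_div]

end OneDimensional

variable {d : ℕ}

/-- Each derivative is a pointwise limit in `x` of difference quotients of the previous one. The
increments are taken to the left, so that `t = 1` needs no separate treatment. -/
theorem measurable_iteratedDerivWithin {X : Type*} [MeasurableSpace X]
    {u : ℝ → X → EuclideanSpace ℝ (Fin d)} (hm : ∀ t ∈ Ioc (0 : ℝ) 1, Measurable (u t))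
    (hu : ∀ x, ContDiffOn ℝ ∞ (fun s => u s x) (Ioc 0 1)) (n : ℕ) :
    ∀ t ∈ Ioc (0 : ℝ) 1,
      Measurable (fun x => iteratedDerivWithin n (fun s => u s x) (Ioc 0 1) t) := by
  induction n with
  | zero => simpa using hm
  | succ n ih =>
    intro t ht
    let h : ℕ → ℝ := fun m => t - t / (m + 2)
    have hpos : ∀ m : ℕ, 0 < t / (m + 2 : ℝ) := fun m => div_pos ht.1 (by positivity)
    have hlt : ∀ m : ℕ, t / (m + 2 : ℝ) < t := fun m =>
      div_lt_self ht.1 (by linarith [(Nat.cast_nonneg m : (0 : ℝ) ≤ m)])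
    have hmem : ∀ m, h m ∈ Ioc (0 : ℝ) 1 := fun m =>
      ⟨sub_pos.2 (hlt m), by linarith [hpos m, ht.2, show h m = t - t / (m + 2) from rfl]⟩
    have hlim : Tendsto h atTop (𝓝[Ioc 0 1 \ {t}] t) := by
      refine tendsto_nhdsWithin_iff.2 ⟨?_, Eventually.of_forall fun m => ⟨hmem m, ?_⟩⟩
      · have h0 : Tendsto (fun m : ℕ => t / (m + 2 : ℝ)) atTop (𝓝 0) :=
          Tendsto.const_div_atTop
            (tendsto_atTop_add_const_right _ _ tendsto_natCast_atTop_atTop) _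
        simpa using h0.const_sub t
      · have := hpos m
        exact (show t - t / (m + 2 : ℝ) < t by linarith).ne
    refine measurable_of_tendsto_metrizable (f := fun m x =>
      slope (iteratedDerivWithin n (fun s => u s x) (Ioc 0 1)) t (h m)) (fun m => ?_) ?_
    · simp only [slope_def_module]
      exact ((ih _ (hmem m)).sub (ih t ht)).const_smul (h m - t)⁻¹
    · refine tendsto_pi_nhds.2 fun x => ?_
      rw [iteratedDerivWithin_succ]
      have hd := ((hu x).differentiableOn_iteratedDerivWithin (m := n)
        (by exact_mod_cast ENat.natCast_lt_top n) (uniqueDiffOn_Ioc 0 1) t ht).hasDerivWithinAt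
      exact (hasDerivWithinAt_iff_tendsto_slope.1 hd).comp hlim

theorem euclideanNorm_le {v : EuclideanSpace ℝ (Fin d)} {B : ℝ} (hB : ∀ i, |v i| ≤ B) :
    ‖v‖ ≤ d * B := by
  have h1 : v = ∑ i, v i • EuclideanSpace.single i (1 : ℝ) := by
    simpa using ((EuclideanSpace.basisFun (Fin d) ℝ).sum_repr v).symm
  calc ‖v‖ = ‖∑ i, v i • EuclideanSpace.single i (1 : ℝ)‖ := congrArg norm h1
    _ ≤ ∑ _i : Fin d, B := (norm_sum_le _ _).trans (Finset.sum_le_sum fun i _ => by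
        rw [norm_smul, PiLp.norm_single, norm_one, mul_one]
        exact hB i)
    _ = d * B := by simp

end TimeAnalyticity

/-! ### Assembly of the estimates. -/

open Filter Topology in
theorem theorem3p1 (d : ℕ) (C : ℝ) :
    ∃ N : ℝ, 1 ≤ N ∧
      ∀ u : ℝ → EuclideanSpace ℝ (Fin d) → EuclideanSpace ℝ (Fin d),
        IsBoundedMildSolution C u →
          (∀ x, ContDiffOn ℝ ∞ (fun s => u s x) (Ioc 0 1)) ∧
          (∀ n : ℕ, 1 ≤ n → ∀ t ∈ Ioc (0 : ℝ) 1,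
            MemLp (fun x => iteratedDerivWithin n (fun s => u s x) (Ioc 0 1) t) ⊤ volume ∧
            ∀ x, t ^ n * ‖iteratedDerivWithin n (fun s => u s x) (Ioc 0 1) t‖
              ≤ N ^ (n + 1) * (n : ℝ) ^ n) ∧
          (∀ x, AnalyticOn ℝ (fun s => u s x) (Ioc 0 1)) := by
  obtain ⟨ε, hε, H⟩ := exists_holomorphic_dilation d C
  have hN0 : 0 ≤ (d : ℝ) * (|C| + 1) := by positivity
  have hN1 : 0 < 2 / ε := by positivity
  -- One `N` absorbs the amplitude `d * (C + 1)`, where `d` passes from coordinates to the Euclidean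
  -- norm, and `n` further ones absorb `(2 / ε) ^ n`. The absolute value makes `1 ≤ N` hold for
  -- every real `C`.
  set N : ℝ := d * (|C| + 1) + 2 / ε + 1 with hN
  refine ⟨N, by linarith, fun u hu => ?_⟩
  have hI : UniqueDiffOn ℝ (Ioc (0 : ℝ) 1) := uniqueDiffOn_Ioc 0 1
  have hana : ∀ x, AnalyticOn ℝ (fun s => u s x) (Ioc 0 1) := by
    intro x t ht
    have h1 : AnalyticWithinAt ℝ (fun s i => u s x i) (Ioc 0 1) t := by
      refine AnalyticWithinAt.pi fun i => ?_
      obtain ⟨F, hF, -, hφ⟩ := H u hu t ht x i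
      exact analyticWithinAt_of_holomorphic_dilation hε ht hF hφ
    have h2 := ((EuclideanSpace.equiv (Fin d) ℝ).symm :
      (Fin d → ℝ) →L[ℝ] EuclideanSpace ℝ (Fin d)).analyticAt (fun i => u t x i)
    exact h2.comp_analyticWithinAt h1
  have hsmooth : ∀ x, ContDiffOn ℝ ∞ (fun s => u s x) (Ioc 0 1) := fun x =>
    (hana x).contDiffOn hI
  have hbound : ∀ n : ℕ, ∀ t ∈ Ioc (0 : ℝ) 1, ∀ x,
      t ^ n * ‖iteratedDerivWithin n (fun s => u s x) (Ioc 0 1) t‖ ≤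
        N ^ (n + 1) * (n : ℝ) ^ n := by
    intro n t ht x
    have hcomp : ∀ i, |iteratedDerivWithin n (fun s => u s x) (Ioc 0 1) t i| ≤
        (n.factorial * (C + 1) * (2 / ε) ^ n) / t ^ n := by
      intro i
      obtain ⟨F, hF, hFb, hφ⟩ := H u hu t ht x i
      have h1 := abs_iteratedDerivWithin_le_of_holomorphic_dilation hε ht hF hFb hφ n
      have h2 := iteratedDerivWithin_clm_comp
        (EuclideanSpace.proj i : EuclideanSpace ℝ (Fin d) →L[ℝ] ℝ)
        (((hsmooth x).of_le (by exact_mod_cast le_top) : ContDiffOn ℝ n _ _) t ht) hI ht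
      exact (congrArg abs h2).symm.trans_le h1
    have h2 := euclideanNorm_le hcomp
    have htn : 0 < t ^ n := pow_pos ht.1 n
    have hCN : (d : ℝ) * (C + 1) ≤ N := by
      have : (d : ℝ) * (C + 1) ≤ d * (|C| + 1) := by
        gcongr
        exact le_abs_self C
      linarith
    calc _ ≤ t ^ n * (d * ((n.factorial * (C + 1) * (2 / ε) ^ n) / t ^ n)) := by gcongr
      _ = (d * (C + 1)) * (2 / ε) ^ n * n.factorial := by field_simp
      _ ≤ N * N ^ n * (n : ℝ) ^ n := by
        have hC1 := hu.nonneg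
        gcongr
        · linarith
        · exact_mod_cast Nat.factorial_le_pow n
      _ = _ := by rw [pow_succ']
  refine ⟨hsmooth, fun n _ t ht => ⟨?_, hbound n t ht⟩, hana⟩
  refine memLp_top_of_bound (measurable_iteratedDerivWithin (fun s hs => hu.measurable_slice hs)
    hsmooth n t ht).aestronglyMeasurable (N ^ (n + 1) * (n : ℝ) ^ n / t ^ n)
    (Eventually.of_forall fun x => ?_)
  rw [le_div_iff₀' (pow_pos ht.1 n)]
  exact hbound n t ht x
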